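/- **Setting.** All logarithms are binary. For distributions $P,Q$ on $\{0,1\}^n$ write $\mathrm{d}_{\mathrm{TV}}(P,Q)=\frac12\sum_x|P(x)-Q(x)|$, and $P[\phi]=\sum_xP(x)\phi(x)$ for $\phi:\{0,1\}^n\to[-1,1]$. A statistical query oracle for $P$ with tolerance $\tau$ answers each query $\phi$ with some $v$ such that $|v-P[\phi]|\le\tau$. A (deterministic, adaptive, computationally unrestricted) algorithm $\epsilon$-learns $P$ from $q$ queries if, for every such oracle, after at most $q$ queries it outputs a representation (in any fixed representation scheme) of a distribution $D$ with $\mathrm{d}_{\mathrm{TV}}(P,D)<\epsilon$. For even $n$, a random brickwork circuit of depth $d$ on $n$ qubits is the product of $d$ layers, each a tensor product of $n/2$ two-qubit gates; the layers act alternately on the pairs $(1,2),(3,4),\dots,(n-1,n)$ and $(2,3),\dots,(n-2,n-1),(n,1)$, and all gates are independent and Haar random in $U(4)$. Its output distribution is $P_U(x)=|\langle x|U|0^n\rangle|^2$. An algorithm $\epsilon$-learns a $\beta$ fraction of the output distributions (from $q$ queries of tolerance $\tau$) if, with probability at least $\beta$ over the gates, it $\epsilon$-learns $P_U$ from $q$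 queries. **Theorem (sublinear depth).** Let $c=1/\log(5/4)$. (i) There is a constant $N$ such that the following holds for all even $n\ge N$, all $d\in\mathbb N$, all $\tau,\epsilon>0$ with $\epsilon\le 1/4-\tau$ and all $\beta$. If some algorithm $\epsilon$-learns a $\beta$ fraction of the output distributions of random brickwork circuits of depth $d$ on $n$ qubits from $q$ queries of tolerance $\tau$, then $$q+1\ \ge\ \frac{(\beta-3/4-\epsilon-\tau)\,\tau^2}{3n}\left(\frac54\right)^{d}\qquad\text{if } c\log n\le d\le c(n+\log n),$$ $$q+1\ \ge\ (\beta-3/4-\epsilon-\tau)\,2^{n-2}\,\tau^2\qquad\text{if } d>c(n+\log n).$$ (ii) Consequently, superpolynomially many queries are needed at depth $d=\omega(\log n)$: let $d=d(n)$ satisfy $\log n=o(d(n))$ and let $\tau,\epsilon,\beta$ depend on $n$ so that, for some fixed $a\in\mathbb N$ and all large $n$, $\epsilon>0$, $\epsilon\le1/4-\tau$, $\tau\ge n^{-a}$ and $\beta-3/4-\epsilon-\tau\ge n^{-a}$ (for instance a positive constant). Then for every $k$ and all sufficiently large even $n$, every such algorithm for depth $d(n)$ needs $q\ge n^k$ queries.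 -/

import Mathlib

open MeasureTheory Filter Asymptotics

noncomputable section

/-! ### Statistical query learning of distributions -/

/-- Probability distributions over a finite domain `X`. -/
abbrev ProbDist (X : Type*) [Fintype X] : Type _ := stdSimplex ℝ X

/-- Query functions `φ : X → [-1, 1]`. -/
abbrev QueryFn (X : Type*) : Type _ := X → Set.Icc (-1 : ℝ) 1

/-- The expectation `P[φ]`. -/
def expect {X : Type*} [Fintype X] (P : ProbDist X) (φ : QueryFn X) : ℝ :=
  ∑ x, P.1 x * (φ x : ℝ)

/-- Total variation distance. -/
def dTV {X : Type*} [Fintype X] (P Q : ProbDist X) : ℝ :=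
  (1 / 2) * ∑ x, |P.1 x - Q.1 x|

/-- `O` is a statistical query oracle of `P` with tolerance `τ`. -/
def IsStatOracle {X : Type*} [Fintype X] (τ : ℝ) (P : ProbDist X)
    (O : QueryFn X → ℝ) : Prop :=
  ∀ φ, |O φ - expect P φ| ≤ τ

/-- A deterministic adaptive statistical query algorithm over the domain `X`: at each point it
either stops and outputs an element of `R` (a representation), or makes a query and continues
depending on the answer. No computational restriction is imposed. -/
inductive SQAlgorithm (X R : Type*) : Type _
  | output (r : R) : SQAlgorithm X R
  | query (φ : QueryFn X) (next : ℝ → SQAlgorithm X R) : SQAlgorithm X R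

/-- The output of an algorithm with oracle `O` when at most `q` queries are allowed
(`none` if it has not stopped after `q` queries). -/
def SQAlgorithm.run {X R : Type*} (O : QueryFn X → ℝ) : ℕ → SQAlgorithm X R → Option R
  | _, .output r => some r
  | 0, .query _ _ => none
  | q + 1, .query φ next => SQAlgorithm.run O q (next (O φ))

/-- "`A` `ε`-learns `P` from `q` statistical queries of tolerance `τ`": for every valid oracle of
`P`, after at most `q` queries, `A` outputs a representation of some distribution which is at total
variation distance less than `ε` from `P`. The distribution represented by `r : R` is `rep r`. -/
def SQAlgorithm.Learns {X R : Type*} [Fintype X] (rep : R → ProbDist X)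
    (A : SQAlgorithm X R) (τ ε : ℝ) (q : ℕ) (P : ProbDist X) : Prop :=
  ∀ O, IsStatOracle τ P O → ∃ r, A.run O q = some r ∧ dTV P (rep r) < ε

/-! ### Brickwork random quantum circuits -/

/-- Bit strings of length `n`. -/
abbrev BitString (n : ℕ) : Type := Fin n → Fin 2

/-- The group `U(4)` of two-qubit gates, acting on the space with basis `{0, 1}²`. -/
abbrev TwoQubitGate : Type := Matrix.unitaryGroup (BitString 2) ℂ

/-- The Borel σ-algebra on `U(4)`. -/
instance instMeasurableSpaceTwoQubitGate : MeasurableSpace TwoQubitGate := borel _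

instance instBorelSpaceTwoQubitGate : BorelSpace TwoQubitGate := ⟨rfl⟩

instance instCompactSpaceTwoQubitGate : CompactSpace TwoQubitGate := by
  refine isCompact_iff_compactSpace.1 (?_ : IsCompact
    ((Matrix.unitaryGroup (BitString 2) ℂ : Submonoid _) :
      Set (Matrix (BitString 2) (BitString 2) ℂ)))
  have hK : IsCompact (Set.pi Set.univ fun _ : BitString 2 =>
      Set.pi Set.univ fun _ : BitString 2 => Metric.closedBall (0 : ℂ) 1) :=
    isCompact_univ_pi fun _ => isCompact_univ_pi fun _ => isCompact_closedBall 0 1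
  refine IsCompact.of_isClosed_subset hK ?_ ?_
  · have h : ((Matrix.unitaryGroup (BitString 2) ℂ : Submonoid _) :
        Set (Matrix (BitString 2) (BitString 2) ℂ)) = {A | A * star A = 1} := by
      ext A
      exact Matrix.mem_unitaryGroup_iff
    rw [h]
    exact isClosed_eq (by fun_prop) continuous_const
  · intro A hA i _ j _
    simpa using entry_norm_bound_of_unitary hA i j

/-- The Haar probability measure on `U(4)`. -/
def haarU4 : Measure TwoQubitGate := Measure.haarMeasure ⊤

/-- The way layer `k` (counting from `0`) groups `n = m * 2` qubits on a ring into `m` neighbouring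
pairs. With qubits numbered `0, …, n - 1`, the two qubits of the `j`-th pair are
`pairing m k (j, 0)` and `pairing m k (j, 1)`: for even `k` these are `2j` and `2j + 1`, for odd
`k` they are `2j + 1` and `2j + 2` modulo `n`. -/
def pairing (m k : ℕ) : Fin m × Fin 2 ≃ Fin (m * 2) :=
  if Even k then finProdFinEquiv else finProdFinEquiv.trans (finRotate (m * 2))

/-- The `2 ^ n × 2 ^ n` matrix of layer `k`, i.e. the tensor product of the two-qubit gates
`G 0, …, G (m - 1)`, where `G j` acts on the `j`-th pair of qubits of that layer. -/
def layerMatrix (m k : ℕ) (G : Fin m → TwoQubitGate) :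
    Matrix (BitString (m * 2)) (BitString (m * 2)) ℂ :=
  fun x y => ∏ j, (G j).1 (fun b => x (pairing m k (j, b))) (fun b => y (pairing m k (j, b)))

/-- Splitting a bit string into the bits of the pairs of layer `k`. -/
def splitBits (m k : ℕ) : BitString (m * 2) ≃ (Fin m → BitString 2) :=
  ((pairing m k).symm.arrowCongr (Equiv.refl (Fin 2))).trans (Equiv.curry (Fin m) (Fin 2) (Fin 2))

theorem layerMatrix_mem (m k : ℕ) (G : Fin m → TwoQubitGate) :
    layerMatrix m k G ∈ Matrix.unitaryGroup (BitString (m * 2)) ℂ := by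
  rw [Matrix.mem_unitaryGroup_iff]
  ext x y
  have h : ∀ j, ∀ u v : BitString 2,
      ∑ w, (G j).1 u w * star ((G j).1 v w) = if u = v then 1 else 0 := by
    intro j u v
    have h1 := congrFun (congrFun (Matrix.mem_unitaryGroup_iff.1 (G j).2) u) v
    simpa [Matrix.mul_apply, Matrix.one_apply, Matrix.star_apply] using h1
  have hs : ∀ (z : BitString (m * 2)) (j : Fin m),
      (fun b => z (pairing m k (j, b))) = splitBits m k z j := fun z j => rfl
  simp only [Matrix.mul_apply, Matrix.star_apply, layerMatrix, hs, star_prod,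
    ← Finset.prod_mul_distrib]
  rw [(splitBits m k).sum_comp
    (fun w => ∏ j, (G j).1 (splitBits m k x j) (w j) * star ((G j).1 (splitBits m k y j) (w j)))]
  have hd := Finset.prod_univ_sum (fun _ : Fin m => (Finset.univ : Finset (BitString 2)))
    (fun j w => (G j).1 (splitBits m k x j) w * star ((G j).1 (splitBits m k y j) w))
  rw [Fintype.piFinset_univ] at hd
  rw [← hd]
  simp only [h, Matrix.one_apply]
  by_cases hxy : x = y
  · simp [hxy]
  · have hne : splitBits m k x ≠ splitBits m k y := fun e => hxy ((splitBits m k).injective e)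
    obtain ⟨j, hj⟩ := Function.ne_iff.1 hne
    rw [if_neg hxy]
    exact Finset.prod_eq_zero (Finset.mem_univ j) (if_neg hj)

/-- Layer `k` as a unitary. -/
def layer (m k : ℕ) (G : Fin m → TwoQubitGate) : Matrix.unitaryGroup (BitString (m * 2)) ℂ :=
  ⟨layerMatrix m k G, layerMatrix_mem m k G⟩

/-- The gates of a brickwork circuit of depth `d` on `m * 2` qubits. -/
abbrev CircuitGates (m d : ℕ) : Type := Fin d → Fin m → TwoQubitGate

/-- The unitary `L_{d-1} ⋯ L_1 L_0` of the brickwork circuit with the given gates. -/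
def brickwork (m : ℕ) : (d : ℕ) → CircuitGates m d → Matrix.unitaryGroup (BitString (m * 2)) ℂ
  | 0, _ => 1
  | d + 1, g => layer m d (g (Fin.last d)) * brickwork m d (fun k => g k.castSucc)

/-- The law of the gates of a random brickwork circuit: i.i.d. Haar random. -/
def randomGates (m d : ℕ) : Measure (CircuitGates m d) :=
  Measure.pi fun _ => Measure.pi fun _ => haarU4

/-- The Born distribution `P_U(x) = |⟨x|U|0ⁿ⟩|²`. -/
def born {n : ℕ} (U : Matrix.unitaryGroup (BitString n) ℂ) : ProbDist (BitString n) :=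
  ⟨fun x => ‖U.1 x 0‖ ^ 2, fun _ => by positivity, by
    have h := congrFun (congrFun (Matrix.mem_unitaryGroup_iff'.1 U.2) 0) 0
    simp only [Matrix.mul_apply, Matrix.star_apply, Matrix.one_apply_eq] at h
    have h2 : ((∑ x, ‖U.1 x 0‖ ^ 2 : ℝ) : ℂ) = 1 := by
      rw [← h]
      push_cast
      refine Finset.sum_congr rfl fun x _ => ?_
      exact (Complex.conj_mul' _).symm
    exact_mod_cast h2⟩

/-- `A` is a deterministic algorithm that `ε`-learns a `β` fraction of the output distributions of
random brickwork circuits of depth `d` on `m * 2` qubits from `q` many `τ`-accurate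
statistical queries. -/
def LearnsBrickworkFraction (m d : ℕ) (τ ε β : ℝ) (q : ℕ) {R : Type*}
    (rep : R → ProbDist (BitString (m * 2))) (A : SQAlgorithm (BitString (m * 2)) R) : Prop :=
  β ≤ (randomGates m d).real {g | A.Learns rep τ ε q (born (brickwork m d g))}

/-- The constant `c = 1 / log (5/4)`, logarithms being binary. -/
def depthConst : ℝ := 1 / Real.logb 2 (5 / 4)

end

universe u

noncomputable section

/-! ### The spin chain of identities and swaps -/

/-! An algorithm whose queries are all answered by their uniform expectations follows one fixed path
to one fixed output, and these answers are valid as long as `P_U[φ]` is within `τ` of the uniform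
value along that path. So learning succeeds with probability at most `q V / τ ^ 2` (Chebyshev, with
`V` a bound on the mean square deviation of `P_U[φ]`) plus the probability that `P_U` is `ε`-close
to one fixed distribution (`measureReal_learns_le`). Two estimates remain.

Variance. Averaging two copies of the state over a Haar gate leaves a combination of the identity
and the swap of the copies (`commutant_eq`). Normalized to trace one, they appear with nonnegative
weights, determined by conservation of the trace and of the swap trace. The averaged two-copy state
is therefore a random configuration of spins, one per gate (`secondMoment_eq`): equal neighbours
persist, unequal ones become a swap with probability `1/5` and an identity with probability `4/5`.
The all-identity configuration amounts to independent uniform outcomes and contributes no variance;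
any other contributes at most its probability (`integral_expect_sub_sq_le_sum`). Conservation of the
global swap trace makes all-swap exponentially unlikely. Configurations with domain walls are
controlled by `wallPotential`, a sum over marked regions of the swap trace of the region, with a
factor `y` per boundary point; boundary points may only sit at domain walls of the spins. One layer
turns `y` into `4/5 * y` (`wallPotential_step`), while under the initial law every region has mean
weight `1`, so a transfer-matrix sum finishes the count. The outcome is `V` of order `2 ^ (-n) + n *
(4/5) ^ d`.

Distance. The mean distance of `P_U` from any fixed distribution is at least `1/4`
(`le_integral_dTV_born`), already because of one gate of the last layer. The mean difference of two
outcome probabilities of a Haar gate is computed by comparing a Haar random vector with a Gaussian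
one. As `dTV ≤ 1`, the distance is below `ε` with probability at most `3/4 + ε`.

The depth thresholds are the points where `(5/4) ^ d` reaches `n`, so that `V` becomes small, and `n
* 2 ^ n`, beyond which `2 ^ (-n)` dominates `V`. -/

/-- The weight `tr(M S) / tr M` (times `2`) of a qubit in state `M`, the swap if `c` is true and the
identity otherwise. -/
def spinWeight (c : Bool) : ℝ := if c then 2 else 1 / 2

/-- The transition probabilities of a pair of spins under a Haar random two-qubit gate. -/
def gateKernel (s t c : Bool) : ℝ :=
  if s = t then (if c = s then 1 else 0) else (if c then 1 / 5 else 4 / 5)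

/-- The law of a spin after the first layer. -/
def initialSpin (c : Bool) : ℝ := if c then 1 / 5 else 4 / 5

/-- The weight of a (possible) domain wall. -/
def wallWeight (y : ℝ) (β₁ β₂ γ₁ γ₂ : Bool) : ℝ :=
  if β₁ = β₂ then 1 else if γ₁ = γ₂ then 0 else y

/-- The weight of a marked spin. -/
def markedWeight (c β : Bool) : ℝ := if β then spinWeight c else 1

/-- The domain wall potential of a spin configuration `c`, where the `j`-th gate acts on the
spins `a j` and `b j`. -/
def wallPotential {I : Type*} [Fintype I] [DecidableEq I] (y : ℝ) (a b : Equiv.Perm I)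
    (c : I → Bool) : ℝ :=
  ∑ B : I → Bool, (∏ i, markedWeight (c i) (B i) ^ 2) *
    ∏ j, wallWeight y (B (a j)) (B (b j)) (c (a j)) (c (b j))

theorem gateKernel_nonneg (s t c : Bool) : 0 ≤ gateKernel s t c := by
  unfold gateKernel; split_ifs <;> norm_num

theorem initialSpin_nonneg (c : Bool) : 0 ≤ initialSpin c := by
  unfold initialSpin; split_ifs <;> norm_num

theorem wallWeight_nonneg {y : ℝ} (hy : 0 ≤ y) (β₁ β₂ γ₁ γ₂ : Bool) :
    0 ≤ wallWeight y β₁ β₂ γ₁ γ₂ := by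
  unfold wallWeight; split_ifs <;> norm_num [hy]

theorem sum_gateKernel (s t : Bool) : ∑ c, gateKernel s t c = 1 := by
  cases s <;> cases t <;> norm_num [gateKernel]

/-- A wall between two new spins is pushed onto the old spin `s` between them. If `γ₁ ≠ γ₂`, then
`s` agrees with exactly one of them; copying the mark of that side leaves a single wall, of weight
`y`, on the other side. Equal marks are covered by `β = β₁`. -/
theorem wallWeight_le_sum {y : ℝ} (hy : 0 ≤ y) (β₁ β₂ γ₁ γ₂ s : Bool) :
    wallWeight y β₁ β₂ γ₁ γ₂ ≤ ∑ β, wallWeight y β₁ β γ₁ s * wallWeight y β₂ β γ₂ s := by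
  cases β₁ <;> cases β₂ <;> cases γ₁ <;> cases γ₂ <;> cases s <;>
    simp [wallWeight] <;> positivity

/-- The source of the factor `4/5`. When `s ≠ t` and `l ≠ r`, the new mark copies `l`, which forces
`c = s`, or copies `r`, which forces `c = t`; both choices contribute the same amount. When `l = r`,
a differing `β` would need `c` to differ from both `s` and `t`, which the kernel excludes. -/
theorem sum_gateKernel_wallWeight (y : ℝ) (s t l r : Bool) :
    ∑ c, gateKernel s t c * ∑ β, markedWeight c β ^ 2 *
      (wallWeight y β l c s * wallWeight y β r c t) =
    markedWeight s l * markedWeight t r * wallWeight (4 / 5 * y) l r s t := by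
  cases s <;> cases t <;> cases l <;> cases r <;>
    simp [wallWeight, markedWeight, gateKernel, spinWeight] <;> ring

/-- Conservation of the swap trace by a gate. For unequal spins this is the equation that fixes the
probability `1/5`. -/
theorem sum_gateKernel_spinWeight_sq (s t : Bool) :
    ∑ c, gateKernel s t c * spinWeight c ^ 2 = spinWeight s * spinWeight t := by
  cases s <;> cases t <;> norm_num [gateKernel, spinWeight]

/-! ### Potentials of a spin configuration and their change under one layer. -/

section Step

variable {I : Type*} [Fintype I] [DecidableEq I]

theorem sum_prod_eq_prod_sum {R : Type*} [CommSemiring R] {κ : Type*} [Fintype κ]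
    (f : I → κ → R) :
    ∑ c : I → κ, ∏ i, f i (c i) = ∏ i, ∑ k, f i k := by
  rw [Finset.prod_univ_sum, Fintype.piFinset_univ]

/-- An old spin `i` enters two gates of the new layer, `a⁻¹ i` and `b⁻¹ i`, and the layer after that
joins exactly the two resulting spins; hence the inverses, with roles exchanged, on the left.
Pushing each wall onto the old spin between (`wallWeight_le_sum`) makes the sum over new spins and
marks factor over gates, and each factor is evaluated by `sum_gateKernel_wallWeight`. -/
theorem wallPotential_step {y : ℝ} (hy : 0 ≤ y) (a b : Equiv.Perm I) (c : I → Bool) :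
    ∑ c' : I → Bool, (∏ j, gateKernel (c (a j)) (c (b j)) (c' j)) *
        wallPotential y b⁻¹ a⁻¹ c' ≤ wallPotential (4 / 5 * y) a b c := by
  have key : ∀ c' : I → Bool, wallPotential y b⁻¹ a⁻¹ c' ≤
      ∑ B : I → Bool, ∏ j, ∑ β, markedWeight (c' j) β ^ 2 *
        (wallWeight y β (B (a j)) (c' j) (c (a j)) *
          wallWeight y β (B (b j)) (c' j) (c (b j))) := by
    intro c'
    have h1 : ∀ B' : I → Bool,
        (∏ j, wallWeight y (B' (b⁻¹ j)) (B' (a⁻¹ j)) (c' (b⁻¹ j)) (c' (a⁻¹ j))) ≤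
        ∑ B : I → Bool, ∏ j, (wallWeight y (B' j) (B (a j)) (c' j) (c (a j)) *
          wallWeight y (B' j) (B (b j)) (c' j) (c (b j))) := by
      intro B'
      calc _ ≤ ∏ i, ∑ β, wallWeight y (B' (b⁻¹ i)) β (c' (b⁻¹ i)) (c i) *
              wallWeight y (B' (a⁻¹ i)) β (c' (a⁻¹ i)) (c i) :=
            Finset.prod_le_prod (fun _ _ => wallWeight_nonneg hy _ _ _ _)
              fun i _ => wallWeight_le_sum hy _ _ _ _ (c i)
        _ = ∑ B : I → Bool, ∏ i, (wallWeight y (B' (b⁻¹ i)) (B i) (c' (b⁻¹ i)) (c i) *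
              wallWeight y (B' (a⁻¹ i)) (B i) (c' (a⁻¹ i)) (c i)) :=
            (sum_prod_eq_prod_sum _).symm
        _ = _ := by
            refine Finset.sum_congr rfl fun B _ => ?_
            -- Each wall factor joins an old spin to a new one; the product over old spins is
            -- regrouped by new gates.
            rw [Finset.prod_mul_distrib, Finset.prod_mul_distrib, mul_comm]
            congr 1
            · rw [← Equiv.prod_comp a]; simp
            · rw [← Equiv.prod_comp b]; simp
    calc wallPotential y b⁻¹ a⁻¹ c'
        ≤ ∑ B' : I → Bool, (∏ i, markedWeight (c' i) (B' i) ^ 2) *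
          ∑ B : I → Bool, ∏ j, (wallWeight y (B' j) (B (a j)) (c' j) (c (a j)) *
            wallWeight y (B' j) (B (b j)) (c' j) (c (b j))) :=
          Finset.sum_le_sum fun B' _ => mul_le_mul_of_nonneg_left (h1 B')
            (Finset.prod_nonneg fun _ _ => sq_nonneg _)
      _ = _ := by
          simp_rw [Finset.mul_sum, ← Finset.prod_mul_distrib]
          rw [Finset.sum_comm]
          exact Finset.sum_congr rfl fun B _ => sum_prod_eq_prod_sum
            (fun j β => markedWeight (c' j) β ^ 2 *
              (wallWeight y β (B (a j)) (c' j) (c (a j)) *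
              wallWeight y β (B (b j)) (c' j) (c (b j))))
  calc _ ≤ ∑ c' : I → Bool, (∏ j, gateKernel (c (a j)) (c (b j)) (c' j)) *
        ∑ B : I → Bool, ∏ j, ∑ β, markedWeight (c' j) β ^ 2 *
        (wallWeight y β (B (a j)) (c' j) (c (a j)) *
          wallWeight y β (B (b j)) (c' j) (c (b j))) :=
        Finset.sum_le_sum fun c' _ => mul_le_mul_of_nonneg_left (key c')
            (Finset.prod_nonneg fun _ _ => gateKernel_nonneg _ _ _)
    _ = _ := by
        simp_rw [Finset.mul_sum (s := (Finset.univ : Finset (I → Bool))),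
          ← Finset.prod_mul_distrib]
        rw [Finset.sum_comm]
        refine Finset.sum_congr rfl fun B _ => ?_
        rw [sum_prod_eq_prod_sum (fun j γ => gateKernel (c (a j)) (c (b j)) γ *
          ∑ β, markedWeight γ β ^ 2 *
            (wallWeight y β (B (a j)) γ (c (a j)) * wallWeight y β (B (b j)) γ (c (b j))))]
        simp_rw [sum_gateKernel_wallWeight]
        -- Every old spin is the `a`-input of one gate and the `b`-input of one gate, so its marked
        -- weight reappears squared.
        rw [Finset.prod_mul_distrib, Finset.prod_mul_distrib,
          Equiv.prod_comp a (fun i => markedWeight (c i) (B i)),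
          Equiv.prod_comp b (fun i => markedWeight (c i) (B i)), ← Finset.prod_mul_distrib]
        simp_rw [← sq]

theorem prod_spinWeight_sq_step (a b : Equiv.Perm I) (c : I → Bool) :
    ∑ c' : I → Bool, (∏ j, gateKernel (c (a j)) (c (b j)) (c' j)) *
      ∏ i, spinWeight (c' i) ^ 2 = ∏ i, spinWeight (c i) ^ 2 := by
  simp_rw [← Finset.prod_mul_distrib]
  rw [sum_prod_eq_prod_sum (fun j γ => gateKernel (c (a j)) (c (b j)) γ *
    spinWeight γ ^ 2)]
  simp_rw [sum_gateKernel_spinWeight_sq]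
  rw [Finset.prod_mul_distrib, Equiv.prod_comp a (fun i => spinWeight (c i)),
    Equiv.prod_comp b (fun i => spinWeight (c i)), ← Finset.prod_mul_distrib]
  simp_rw [← sq]

theorem sum_prod_gateKernel (a b : Equiv.Perm I) (c : I → Bool) :
    ∑ c' : I → Bool, (∏ j, gateKernel (c (a j)) (c (b j)) (c' j)) = 1 := by
  rw [sum_prod_eq_prod_sum (fun j γ => gateKernel (c (a j)) (c (b j)) γ)]
  exact Finset.prod_eq_one fun j _ => sum_gateKernel _ _

/-- Configurations other than the all-identity one are controlled by the two potentials. -/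
theorem indicator_ne_le (a b : Equiv.Perm I) (c : I → Bool) :
    (if c = fun _ => false then (0 : ℝ) else 1) ≤
      (1 / 4) ^ Fintype.card I * ∏ i, spinWeight (c i) ^ 2 +
        (wallPotential 1 a b c - 1 - ∏ i, spinWeight (c i) ^ 2) / 4 := by
  set F : (I → Bool) → ℝ := fun B => (∏ i, markedWeight (c i) (B i) ^ 2) *
    ∏ j, wallWeight 1 (B (a j)) (B (b j)) (c (a j)) (c (b j)) with hF
  have hF0 : ∀ B, 0 ≤ F B := fun B => mul_nonneg (Finset.prod_nonneg fun _ _ => sq_nonneg _)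
    (Finset.prod_nonneg fun _ _ => wallWeight_nonneg zero_le_one _ _ _ _)
  have hA : 0 ≤ ∏ i, spinWeight (c i) ^ 2 := Finset.prod_nonneg fun _ _ => sq_nonneg _
  have hfalse : F (fun _ => false) = 1 := by simp [hF, markedWeight, wallWeight]
  have htrue : F (fun _ => true) = ∏ i, spinWeight (c i) ^ 2 := by
    simp [hF, markedWeight, wallWeight]
  have hW : wallPotential 1 a b c = ∑ B, F B := rfl
  have hle : ∀ s : Finset (I → Bool), ∑ B ∈ s, F B ≤ wallPotential 1 a b c := fun s => by
    rw [hW]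
    exact Finset.sum_le_sum_of_subset_of_nonneg (Finset.subset_univ _) fun B _ _ => hF0 B
  by_cases hI : IsEmpty I
  · have hc : c = fun _ => false := Subsingleton.elim _ _
    have h2 := hle {fun _ => false}
    rw [Finset.sum_singleton, hfalse] at h2
    rw [if_pos hc]
    simp only [Finset.univ_eq_empty, Finset.prod_empty, Fintype.card_eq_zero, pow_zero]
    linarith
  rw [not_isEmpty_iff] at hI
  have hne : (fun _ : I => false) ≠ fun _ => true := fun h => by
    simpa using congrFun h hI.some
  have h2 : 1 + ∏ i, spinWeight (c i) ^ 2 ≤ wallPotential 1 a b c := by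
    have := hle {fun _ => false, fun _ => true}
    rwa [Finset.sum_pair hne, hfalse, htrue] at this
  split_ifs with hc
  · have := mul_nonneg (pow_nonneg (by norm_num : (0 : ℝ) ≤ 1 / 4) (Fintype.card I)) hA
    linarith
  -- The all-swap configuration has no walls; it is paid for by its swap weight, which is `4` per
  -- spin.
  by_cases ht : c = fun _ => true
  · have : (1 / 4 : ℝ) ^ Fintype.card I * ∏ i, spinWeight (c i) ^ 2 = 1 := by
      rw [ht]
      simp only [spinWeight, if_true, Finset.prod_const, Finset.card_univ]
      rw [← mul_pow]; norm_num
    linarith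
  -- For a mixed configuration the marking `B = c` has its walls exactly where the spins differ, so
  -- none of its factors vanishes. It marks at least one swap, of weight `2 ^ 2`, and is distinct
  -- from the two constant markings.
  · have hcF : 4 ≤ F c := by
      have h1 : (∏ j, wallWeight 1 (c (a j)) (c (b j)) (c (a j)) (c (b j))) = 1 :=
        Finset.prod_eq_one fun j _ => by unfold wallWeight; split_ifs <;> rfl
      simp only [hF, h1, mul_one]
      obtain ⟨i, hi⟩ := Function.ne_iff.1 hc
      have hi' : c i = true := by simpa using hi
      have h3 : ∀ k, 1 ≤ markedWeight (c k) (c k) ^ 2 := fun k => by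
        cases c k <;> norm_num [markedWeight, spinWeight]
      calc (4 : ℝ) = markedWeight (c i) (c i) ^ 2 := by
            rw [hi']; norm_num [markedWeight, spinWeight]
        _ ≤ _ := by
          rw [← Finset.mul_prod_erase _ _ (Finset.mem_univ i)]
          exact le_mul_of_one_le_right (sq_nonneg _) (Finset.one_le_prod fun k _ => h3 k)
    have h3 : 1 + ∏ i, spinWeight (c i) ^ 2 + F c ≤ wallPotential 1 a b c := by
      have := hle {fun _ => false, fun _ => true, c}
      rw [Finset.sum_insert (by simp [hne, Ne.symm hc]), Finset.sum_pair (Ne.symm ht), hfalse,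
        htrue] at this
      linarith
    have := mul_nonneg (pow_nonneg (by norm_num : (0 : ℝ) ≤ 1 / 4) (Fintype.card I)) hA
    linarith

/-- Under the initial law the mean squared weight of a marked spin is `1/5 * 4 + 4/5 * 1/4 = 1`, so
only wall factors survive. The condition that the spins differ at a wall is dropped, which only
increases the sum. -/
theorem sum_initialSpin_wallPotential_le {y : ℝ} (hy : 0 ≤ y) (a b : Equiv.Perm I) :
    ∑ c : I → Bool, (∏ i, initialSpin (c i)) * wallPotential y a b c ≤
      ∑ B : I → Bool, ∏ j, (if B (a j) = B (b j) then 1 else y) := by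
  have h1 : ∀ c : I → Bool, wallPotential y a b c ≤ ∑ B : I → Bool,
      (∏ i, markedWeight (c i) (B i) ^ 2) * ∏ j, (if B (a j) = B (b j) then 1 else y) := by
    intro c
    refine Finset.sum_le_sum fun B _ => mul_le_mul_of_nonneg_left ?_
      (Finset.prod_nonneg fun _ _ => sq_nonneg _)
    refine Finset.prod_le_prod (fun _ _ => wallWeight_nonneg hy _ _ _ _) fun j _ => ?_
    unfold wallWeight
    split_ifs <;> first | exact le_rfl | exact hy
  calc _ ≤ ∑ c : I → Bool, (∏ i, initialSpin (c i)) * ∑ B : I → Bool,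
      (∏ i, markedWeight (c i) (B i) ^ 2) * ∏ j, (if B (a j) = B (b j) then 1 else y) :=
        Finset.sum_le_sum fun c _ => mul_le_mul_of_nonneg_left (h1 c)
          (Finset.prod_nonneg fun _ _ => initialSpin_nonneg _)
    _ = _ := by
        simp_rw [Finset.mul_sum, ← mul_assoc]
        rw [Finset.sum_comm]
        refine Finset.sum_congr rfl fun B _ => ?_
        rw [← Finset.sum_mul]
        simp_rw [← Finset.prod_mul_distrib]
        rw [sum_prod_eq_prod_sum
          (fun i γ => initialSpin γ * markedWeight γ (B i) ^ 2)]
        rw [Finset.prod_eq_one, one_mul]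
        intro i _
        cases B i <;> norm_num [initialSpin, markedWeight, spinWeight]

end Step

/-- The partition function of an open chain. -/
theorem sum_chain (y : ℝ) (m : ℕ) (s : Bool) :
    ∑ B : Fin m → Bool, ∏ j : Fin m,
      (if (Fin.cons s B : Fin (m + 1) → Bool) j.castSucc = B j then 1 else y) = (1 + y) ^ m := by
  induction m generalizing s with
  | zero => simp
  | succ m ih =>
    rw [← (Fin.consEquiv fun _ => Bool).sum_comp, Fintype.sum_prod_type]
    have : ∀ t : Bool, ∑ B : Fin m → Bool, ∏ j : Fin (m + 1),
        (if (Fin.cons s (Fin.consEquiv (fun _ => Bool) (t, B)) : Fin (m + 2) → Bool) j.castSucc =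
          Fin.consEquiv (fun _ => Bool) (t, B) j then 1 else y) =
        (if s = t then 1 else y) * (1 + y) ^ m := by
      intro t
      rw [← ih t, Finset.mul_sum]
      refine Finset.sum_congr rfl fun B _ => ?_
      rw [Fin.prod_univ_succ]
      congr 1
    simp_rw [this, ← Finset.sum_mul]
    rw [pow_succ, mul_comm]
    congr 1
    cases s <;> simp [add_comm]

/-- The partition function of a closed chain is at most that of an open chain. -/
theorem sum_ring_le {y : ℝ} (hy : 0 ≤ y) (hy1 : y ≤ 1) (m : ℕ) (b : Equiv.Perm (Fin (m + 1)))
    (hb : ∀ j : Fin m, b j.castSucc = j.succ) :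
    ∑ B : Fin (m + 1) → Bool, ∏ j, (if B j = B (b j) then 1 else y) ≤ 2 * (1 + y) ^ m := by
  have h0 : ∀ p : Prop, ∀ _ : Decidable p, 0 ≤ (if p then (1 : ℝ) else y) := fun p _ => by
    split_ifs <;> norm_num [hy]
  have h1 : ∀ p : Prop, ∀ _ : Decidable p, (if p then (1 : ℝ) else y) ≤ 1 := fun p _ => by
    split_ifs <;> norm_num [hy1]
  calc _ ≤ ∑ B : Fin (m + 1) → Bool, ∏ j : Fin m, (if B j.castSucc = B j.succ then 1 else y) := by
        refine Finset.sum_le_sum fun B _ => ?_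
        -- The bond that closes the ring has a factor at most `1` and is discarded.
        rw [Fin.prod_univ_castSucc]
        simp_rw [hb]
        exact mul_le_of_le_one_right (Finset.prod_nonneg fun _ _ => h0 _ _) (h1 _ _)
    _ = _ := by
        rw [← (Fin.consEquiv fun _ => Bool).sum_comp, Fintype.sum_prod_type]
        have : ∀ s : Bool, ∑ B : Fin m → Bool, ∏ j : Fin m,
            (if Fin.consEquiv (fun _ => Bool) (s, B) j.castSucc =
              Fin.consEquiv (fun _ => Bool) (s, B) j.succ then 1 else y) = (1 + y) ^ m := by
          intro s
          rw [← sum_chain y m s]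
          rfl
        simp_rw [this]
        simp

/-- The pair of layer `k` that contains the first qubit of the `j`-th pair of layer `k + 1`. -/
def leftPair (m k : ℕ) : Equiv.Perm (Fin m) := if Even k then 1 else (finRotate m)⁻¹

/-- The pair of layer `k` that contains the second qubit of the `j`-th pair of layer `k + 1`. -/
def rightPair (m k : ℕ) : Equiv.Perm (Fin m) := if Even k then finRotate m else 1

/-- The staggering of the layers exchanges left and right and inverts the neighbour maps, the form
in which `wallPotential_step` iterates. -/
theorem leftPair_succ (m k : ℕ) : leftPair m (k + 1) = (rightPair m k)⁻¹ := by
  unfold leftPair rightPair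
  by_cases h : Even k <;> simp [h, Nat.even_add_one]

theorem rightPair_succ (m k : ℕ) : rightPair m (k + 1) = (leftPair m k)⁻¹ := by
  unfold leftPair rightPair
  by_cases h : Even k <;> simp [h, Nat.even_add_one]

/-- The law of the spins after layer `k`. -/
def spinLaw (m : ℕ) : ℕ → (Fin m → Bool) → ℝ
  | 0 => fun c => ∏ i, initialSpin (c i)
  | k + 1 => fun c' => ∑ c : Fin m → Bool, spinLaw m k c *
      ∏ j, gateKernel (c (leftPair m k j)) (c (rightPair m k j)) (c' j)

theorem spinLaw_nonneg (m k : ℕ) (c : Fin m → Bool) : 0 ≤ spinLaw m k c := by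
  induction k generalizing c with
  | zero => exact Finset.prod_nonneg fun _ _ => initialSpin_nonneg _
  | succ k ih =>
    exact Finset.sum_nonneg fun c _ => mul_nonneg (ih c)
      (Finset.prod_nonneg fun _ _ => gateKernel_nonneg _ _ _)

theorem sum_spinLaw_succ_mul (m k : ℕ) (f : (Fin m → Bool) → ℝ) :
    ∑ c, spinLaw m (k + 1) c * f c = ∑ c, spinLaw m k c * ∑ c' : Fin m → Bool,
      (∏ j, gateKernel (c (leftPair m k j)) (c (rightPair m k j)) (c' j)) * f c' := by
  simp only [spinLaw, Finset.sum_mul, Finset.mul_sum, mul_assoc]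
  exact Finset.sum_comm

theorem sum_spinLaw (m k : ℕ) : ∑ c, spinLaw m k c = 1 := by
  induction k with
  | zero =>
    simp only [spinLaw]
    rw [sum_prod_eq_prod_sum (fun _ γ => initialSpin γ)]
    exact Finset.prod_eq_one fun _ _ => by norm_num [initialSpin]
  | succ k ih =>
    have := sum_spinLaw_succ_mul m k fun _ => 1
    simp only [mul_one, sum_prod_gateKernel] at this
    rw [this, ih]

theorem sum_spinLaw_prod_spinWeight_sq (m k : ℕ) :
    ∑ c, spinLaw m k c * ∏ i, spinWeight (c i) ^ 2 = 1 := by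
  induction k with
  | zero =>
    simp only [spinLaw, ← Finset.prod_mul_distrib]
    rw [sum_prod_eq_prod_sum (fun _ γ => initialSpin γ * spinWeight γ ^ 2)]
    exact Finset.prod_eq_one fun _ _ => by norm_num [initialSpin, spinWeight]
  | succ k ih =>
    rw [sum_spinLaw_succ_mul]
    simp_rw [prod_spinWeight_sq_step]
    exact ih

/-- Undoing one layer multiplies the wall weight by `4/5`; `y` must vary in the induction for this
reason. -/
theorem sum_spinLaw_wallPotential_le {y : ℝ} (hy : 0 ≤ y) (m k : ℕ) :
    ∑ c, spinLaw m k c * wallPotential y (leftPair m k) (rightPair m k) c ≤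
      ∑ c, spinLaw m 0 c *
        wallPotential ((4 / 5) ^ k * y) (leftPair m 0) (rightPair m 0) c := by
  induction k generalizing y with
  | zero => simp
  | succ k ih =>
    rw [sum_spinLaw_succ_mul, leftPair_succ, rightPair_succ]
    refine (Finset.sum_le_sum fun c _ => mul_le_mul_of_nonneg_left
      (wallPotential_step hy _ _ c) (spinLaw_nonneg m k c)).trans ?_
    rw [pow_succ, mul_assoc]
    exact ih (by positivity)

/-- The probability that not all spins are identities after layer `k`. -/
theorem sum_spinLaw_indicator_le (m k : ℕ) :
    ∑ c, spinLaw (m + 1) k c * (if c = fun _ => false then (0 : ℝ) else 1) ≤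
      (1 / 4) ^ (m + 1) + ((1 + (4 / 5) ^ k) ^ m - 1) / 2 := by
  have hy : (0 : ℝ) ≤ (4 / 5) ^ k := by positivity
  have hy1 : (4 / 5 : ℝ) ^ k ≤ 1 := pow_le_one₀ (by norm_num) (by norm_num)
  have h1 := (sum_spinLaw_wallPotential_le zero_le_one (m + 1) k).trans
    (sum_initialSpin_wallPotential_le (by rw [mul_one]; exact hy) _ _)
  have h2 := sum_ring_le hy hy1 m (finRotate (m + 1)) fun j => by simp
  have hl : leftPair (m + 1) 0 = 1 := by simp [leftPair]
  have hr : rightPair (m + 1) 0 = finRotate (m + 1) := by simp [rightPair]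
  simp only [mul_one, hl, hr, Equiv.Perm.coe_one, id_eq] at h1
  refine (Finset.sum_le_sum fun c _ => mul_le_mul_of_nonneg_left
    (indicator_ne_le (leftPair (m + 1) k) (rightPair (m + 1) k) c)
    (spinLaw_nonneg (m + 1) k c)).trans ?_
  have h3 := sum_spinLaw_prod_spinWeight_sq (m + 1) k
  have h4 := sum_spinLaw (m + 1) k
  have h5 : ∑ c, spinLaw (m + 1) k c * ((1 / 4) ^ Fintype.card (Fin (m + 1)) *
      ∏ i, spinWeight (c i) ^ 2 + (wallPotential 1 (leftPair (m + 1) k) (rightPair (m + 1) k) c -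
        1 - ∏ i, spinWeight (c i) ^ 2) / 4) =
      (1 / 4) ^ (m + 1) * ∑ c, spinLaw (m + 1) k c * ∏ i, spinWeight (c i) ^ 2 +
      (∑ c, spinLaw (m + 1) k c * wallPotential 1 (leftPair (m + 1) k) (rightPair (m + 1) k) c -
        ∑ c, spinLaw (m + 1) k c -
        ∑ c, spinLaw (m + 1) k c * ∏ i, spinWeight (c i) ^ 2) / 4 := by
    rw [← Finset.sum_sub_distrib, ← Finset.sum_sub_distrib, Finset.sum_div, Finset.mul_sum,
      ← Finset.sum_add_distrib]
    refine Finset.sum_congr rfl fun c _ => ?_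
    rw [Fintype.card_fin]
    ring
  -- Total mass and mean swap weight are both `1`, so what remains is `4 ^ (-(m + 1))` plus a
  -- quarter of `2 * (1 + y) ^ m - 1 - 1`, where `y = (4/5) ^ k`.
  rw [h5, h3, h4]
  have h6 := h1.trans h2
  linarith

/-! ### Haar integrals over two-qubit gates -/

instance instSecondCountableTwoQubitGate : SecondCountableTopology TwoQubitGate :=
  inferInstanceAs (SecondCountableTopology
    {A : BitString 2 → BitString 2 → ℂ // A ∈ (Matrix.unitaryGroup (BitString 2) ℂ)})

instance instIsHaarMeasureHaarU4 : haarU4.IsHaarMeasure := by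
  unfold haarU4; infer_instance

instance instIsProbabilityMeasureHaarU4 : IsProbabilityMeasure haarU4 :=
  ⟨by simpa [haarU4] using
    Measure.haarMeasure_self (K₀ := (⊤ : TopologicalSpace.PositiveCompacts TwoQubitGate))⟩

/-- Compact groups are unimodular: a right translate of the measure is again a Haar probability
measure, and there is only one. -/
instance instIsMulRightInvariantHaarU4 : haarU4.IsMulRightInvariant := by
  refine ⟨fun h => ?_⟩
  have h1 : Measure.IsHaarMeasure (Measure.map (· * h) haarU4) := by
    infer_instance
  have h2 : IsProbabilityMeasure (Measure.map (· * h) haarU4) :=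
    Measure.isProbabilityMeasure_map (measurable_mul_const h).aemeasurable
  exact Measure.isHaarMeasure_eq_of_isProbabilityMeasure _ _

theorem continuous_gate_apply (a b : BitString 2) : Continuous fun g : TwoQubitGate => g.1 a b := by
  have : Continuous fun g : TwoQubitGate => (g.1 : BitString 2 → BitString 2 → ℂ) :=
    continuous_subtype_val
  exact (continuous_apply b).comp ((continuous_apply a).comp this)

open scoped Kronecker

/-- The action of `g ⊗ g` by conjugation. -/
def conjTwo (g : Matrix (BitString 2) (BitString 2) ℂ)
    (M : Matrix (BitString 2 × BitString 2) (BitString 2 × BitString 2) ℂ) :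
    Matrix (BitString 2 × BitString 2) (BitString 2 × BitString 2) ℂ :=
  (g ⊗ₖ g) * M * (g ⊗ₖ g).conjTranspose

/-- The second-moment twirl. -/
def twirl (M : Matrix (BitString 2 × BitString 2) (BitString 2 × BitString 2) ℂ) :
    Matrix (BitString 2 × BitString 2) (BitString 2 × BitString 2) ℂ :=
  Matrix.of fun p q => ∫ g, conjTwo g.1 M p q ∂haarU4

/-- The swap of the two copies. -/
def swapTwo : Matrix (BitString 2 × BitString 2) (BitString 2 × BitString 2) ℂ :=
  Matrix.of fun p q => if p = q.swap then 1 else 0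

theorem conjTwo_mul (g h : Matrix (BitString 2) (BitString 2) ℂ)
    (M : Matrix (BitString 2 × BitString 2) (BitString 2 × BitString 2) ℂ) :
    conjTwo (g * h) M = conjTwo g (conjTwo h M) := by
  simp only [conjTwo, Matrix.mul_kronecker_mul, Matrix.conjTranspose_mul, Matrix.mul_assoc]

theorem conjTwo_apply (g : Matrix (BitString 2) (BitString 2) ℂ)
    (M : Matrix (BitString 2 × BitString 2) (BitString 2 × BitString 2) ℂ)
    (a a' b b' : BitString 2) :
    conjTwo g M (a, a') (b, b') = ∑ v, ∑ v', ∑ w, ∑ w',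
      g a w * g a' w' * star (g b v) * star (g b' v') * M (w, w') (v, v') := by
  simp only [conjTwo, Matrix.mul_apply, Matrix.conjTranspose_apply, Matrix.kroneckerMap_apply,
    Fintype.sum_prod_type, Finset.sum_mul, star_mul']
  refine Finset.sum_congr rfl fun v _ => Finset.sum_congr rfl fun v' _ =>
    Finset.sum_congr rfl fun w _ => Finset.sum_congr rfl fun w' _ => ?_
  ring

theorem continuous_conjTwo (M : Matrix (BitString 2 × BitString 2) (BitString 2 × BitString 2) ℂ)
    (p q : BitString 2 × BitString 2) :
    Continuous fun g : TwoQubitGate => conjTwo g.1 M p q := by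
  obtain ⟨a, a'⟩ := p
  obtain ⟨b, b'⟩ := q
  simp only [conjTwo_apply]
  refine continuous_finsetSum _ fun v _ => continuous_finsetSum _ fun v' _ =>
    continuous_finsetSum _ fun w _ => continuous_finsetSum _ fun w' _ => ?_
  exact ((((continuous_gate_apply a w).mul (continuous_gate_apply a' w')).mul
    (continuous_star.comp (continuous_gate_apply b v))).mul
    (continuous_star.comp (continuous_gate_apply b' v'))).mul continuous_const

theorem integrable_of_continuous {f : TwoQubitGate → ℂ} (hf : Continuous f) :
    Integrable f haarU4 :=
  hf.integrable_of_hasCompactSupport (HasCompactSupport.of_compactSpace f)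

theorem conjTwo_twirl (h : TwoQubitGate)
    (M : Matrix (BitString 2 × BitString 2) (BitString 2 × BitString 2) ℂ) :
    conjTwo h.1 (twirl M) = twirl M := by
  ext p q
  have h1 : conjTwo h.1 (twirl M) p q = ∫ g, conjTwo h.1 (conjTwo g.1 M) p q ∂haarU4 := by
    obtain ⟨a, a'⟩ := p
    obtain ⟨b, b'⟩ := q
    simp only [conjTwo_apply h.1]
    have hc : ∀ p q, Integrable (fun g : TwoQubitGate => conjTwo g.1 M p q) haarU4 :=
      fun p q => integrable_of_continuous (continuous_conjTwo M p q)
    rw [integral_finsetSum _ fun v _ => integrable_finsetSum _ fun v' _ =>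
      integrable_finsetSum _ fun w _ => integrable_finsetSum _ fun w' _ => (hc _ _).const_mul _]
    refine Finset.sum_congr rfl fun v _ => ?_
    rw [integral_finsetSum _ fun v' _ =>
      integrable_finsetSum _ fun w _ => integrable_finsetSum _ fun w' _ => (hc _ _).const_mul _]
    refine Finset.sum_congr rfl fun v' _ => ?_
    rw [integral_finsetSum _ fun w _ => integrable_finsetSum _ fun w' _ => (hc _ _).const_mul _]
    refine Finset.sum_congr rfl fun w _ => ?_
    rw [integral_finsetSum _ fun w' _ => (hc _ _).const_mul _]
    refine Finset.sum_congr rfl fun w' _ => ?_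
    rw [integral_const_mul]
    rfl
  rw [h1]
  simp only [← conjTwo_mul]
  exact integral_mul_left_eq_self (fun g : TwoQubitGate => conjTwo g.1 M p q) h

/-- Invariance of the Haar measure places the twirl in the commutant of all `h ⊗ h`. -/
theorem kronecker_mul_twirl (h : TwoQubitGate)
    (M : Matrix (BitString 2 × BitString 2) (BitString 2 × BitString 2) ℂ) :
    (h.1 ⊗ₖ h.1) * twirl M = twirl M * (h.1 ⊗ₖ h.1) := by
  have h2 : (h.1 ⊗ₖ h.1).conjTranspose * (h.1 ⊗ₖ h.1) = 1 := by
    rw [Matrix.conjTranspose_kronecker, ← Matrix.mul_kronecker_mul]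
    have := Matrix.mem_unitaryGroup_iff'.1 h.2
    rw [Matrix.star_eq_conjTranspose] at this
    rw [this, Matrix.one_kronecker_one]
  conv_rhs => rw [← conjTwo_twirl h M, conjTwo, Matrix.mul_assoc, h2, Matrix.mul_one]

theorem trace_conjTwo (g : TwoQubitGate)
    (M : Matrix (BitString 2 × BitString 2) (BitString 2 × BitString 2) ℂ) :
    (conjTwo g.1 M).trace = M.trace := by
  have h2 : (g.1 ⊗ₖ g.1).conjTranspose * (g.1 ⊗ₖ g.1) = 1 := by
    rw [Matrix.conjTranspose_kronecker, ← Matrix.mul_kronecker_mul]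
    have := Matrix.mem_unitaryGroup_iff'.1 g.2
    rw [Matrix.star_eq_conjTranspose] at this
    rw [this, Matrix.one_kronecker_one]
  rw [conjTwo, Matrix.trace_mul_comm, ← Matrix.mul_assoc, h2, Matrix.one_mul]

theorem swapTwo_mul_apply (M : Matrix (BitString 2 × BitString 2) (BitString 2 × BitString 2) ℂ)
    (p q : BitString 2 × BitString 2) : (swapTwo * M) p q = M p.swap q := by
  rw [Matrix.mul_apply, Finset.sum_eq_single p.swap]
  · simp [swapTwo]
  · intro r _ hr
    have : p ≠ r.swap := fun h => hr (by rw [h, Prod.swap_swap])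
    simp [swapTwo, this]
  · simp

theorem mul_swapTwo_apply (M : Matrix (BitString 2 × BitString 2) (BitString 2 × BitString 2) ℂ)
    (p q : BitString 2 × BitString 2) : (M * swapTwo) p q = M p q.swap := by
  rw [Matrix.mul_apply, Finset.sum_eq_single q.swap]
  · simp [swapTwo]
  · intro r _ hr
    simp [swapTwo, hr]
  · simp

theorem swapTwo_mul_conjTwo (g : Matrix (BitString 2) (BitString 2) ℂ)
    (M : Matrix (BitString 2 × BitString 2) (BitString 2 × BitString 2) ℂ) :
    swapTwo * conjTwo g M = conjTwo g (swapTwo * M) := by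
  have : swapTwo * (g ⊗ₖ g) = (g ⊗ₖ g) * swapTwo := by
    ext ⟨a, a'⟩ ⟨b, b'⟩
    rw [swapTwo_mul_apply, mul_swapTwo_apply]
    simp [mul_comm]
  rw [conjTwo, conjTwo, ← Matrix.mul_assoc, ← Matrix.mul_assoc, this]
  simp only [Matrix.mul_assoc]

theorem trace_twirl (M : Matrix (BitString 2 × BitString 2) (BitString 2 × BitString 2) ℂ) :
    (twirl M).trace = M.trace := by
  simp only [Matrix.trace, Matrix.diag, twirl, Matrix.of_apply]
  rw [← integral_finsetSum _ fun p _ => integrable_of_continuous (continuous_conjTwo M p p)]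
  have : ∀ g : TwoQubitGate, ∑ p, conjTwo g.1 M p p = ∑ p, M p p := fun g => trace_conjTwo g M
  simp [this]

/-- The swap commutes with `g ⊗ g`. Together with `trace_twirl` this supplies the two conserved
quantities that determine the twirl. -/
theorem trace_swapTwo_mul_twirl
    (M : Matrix (BitString 2 × BitString 2) (BitString 2 × BitString 2) ℂ) :
    (swapTwo * twirl M).trace = (swapTwo * M).trace := by
  have h : swapTwo * twirl M = twirl (swapTwo * M) := by
    ext p q
    rw [swapTwo_mul_apply]
    simp only [twirl, Matrix.of_apply, ← swapTwo_mul_conjTwo, swapTwo_mul_apply]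
  rw [h, trace_twirl]

/-- The gate that permutes the computational basis by `π⁻¹`. -/
def permGate (π : Equiv.Perm (BitString 2)) : TwoQubitGate :=
  ⟨Matrix.of fun x y : BitString 2 => if π x = y then (1 : ℂ) else 0, by
    rw [Matrix.mem_unitaryGroup_iff]
    ext x y
    simp [Matrix.mul_apply, Matrix.star_apply, Matrix.one_apply, eq_comm]⟩

/-! ### Operators commuting with all `h ⊗ h`. -/

section Commutant

variable {N : Matrix (BitString 2 × BitString 2) (BitString 2 × BitString 2) ℂ}

/-- The diagonal gate with phase `I` at `k` detects how often `k` occurs in a pair, because `1`,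
`I`, `-1` are distinct. A nonzero entry therefore needs `{a, a'} = {b, b'}` with multiplicity. -/
theorem commutant_phase (hN : ∀ h : TwoQubitGate, (h.1 ⊗ₖ h.1) * N = N * (h.1 ⊗ₖ h.1))
    (a a' b b' : BitString 2) (h : N (a, a') (b, b') ≠ 0) :
    (a = b ∧ a' = b') ∨ (a = b' ∧ a' = b) := by
  have key : ∀ k : BitString 2, (if a = k then Complex.I else 1) * (if a' = k then Complex.I else 1)
      = (if b = k then Complex.I else 1) * (if b' = k then Complex.I else 1) := by
    intro k
    have hu : Matrix.diagonal (fun x : BitString 2 => if x = k then Complex.I else 1) ∈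
        Matrix.unitaryGroup (BitString 2) ℂ := by
      rw [Matrix.mem_unitaryGroup_iff, Matrix.star_eq_conjTranspose,
        Matrix.diagonal_conjTranspose, Matrix.diagonal_mul_diagonal, ← Matrix.diagonal_one]
      congr 1
      ext x
      by_cases hx : x = k <;> simp [hx]
    have h1 := congrFun (congrFun (hN ⟨_, hu⟩) (a, a')) (b, b')
    simp only [Matrix.diagonal_kronecker_diagonal, Matrix.diagonal_mul, Matrix.mul_diagonal] at h1
    rw [mul_comm (N _ _)] at h1
    exact mul_right_cancel₀ h h1
  have hI1 : Complex.I ≠ 1 := fun h => by simpa using congrArg Complex.im h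
  have hI2 : (-1 : ℂ) ≠ 1 := by norm_num
  have hI3 : (-1 : ℂ) ≠ Complex.I := fun h => by simpa using congrArg Complex.im h
  have h1 := key a
  have h2 := key a'
  by_cases e1 : a = b
  · subst e1
    left
    refine ⟨rfl, ?_⟩
    by_contra e2
    by_cases e3 : a = a'
    · subst e3
      simp [Ne.symm e2, hI3] at h1
    · simp [e3, Ne.symm e2, hI1] at h2
  · by_cases e4 : a = b'
    · subst e4
      right
      refine ⟨rfl, ?_⟩
      by_contra e2
      by_cases e3 : a = a'
      · subst e3
        simp [Ne.symm e2, hI3] at h1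
      · simp [e3, Ne.symm e2, hI1] at h2
    · exfalso
      by_cases e3 : a' = a
      · subst e3
        simp [Ne.symm e1, Ne.symm e4, hI2] at h1
      · simp [e3, Ne.symm e1, Ne.symm e4, hI1] at h1

theorem commutant_perm (hN : ∀ h : TwoQubitGate, (h.1 ⊗ₖ h.1) * N = N * (h.1 ⊗ₖ h.1))
    (π : Equiv.Perm (BitString 2)) (a a' b b' : BitString 2) :
    N (π a, π a') (π b, π b') = N (a, a') (b, b') := by
  have h1 := congrFun (congrFun (hN (permGate π)) (a, a')) (π b, π b')
  simpa [permGate, Matrix.mul_apply, Fintype.sum_prod_type, ite_and, mul_ite, ite_mul] using h1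

/-- The unitary `1 - J / 2`, where `J` is the all-ones matrix. -/
theorem reflection_mem : (Matrix.of fun x y : BitString 2 => (if x = y then (1 : ℂ) else 0) - 1 / 2) ∈
    Matrix.unitaryGroup (BitString 2) ℂ := by
  rw [Matrix.mem_unitaryGroup_iff]
  ext x y
  simp only [Matrix.mul_apply, Matrix.star_apply, Matrix.one_apply, Matrix.of_apply, sub_mul,
    mul_sub, Finset.sum_sub_distrib, star_sub, apply_ite star, star_one, star_zero]
  simp [eq_comm]
  ring

/-- Phases and permutations leave three free parameters; a gate that mixes basis vectors gives the
missing relation. In the entry at `(o, o)`, `(o, e)` all surviving terms carry the same coefficient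
`1/2 * (-1/2)`, which cancels. -/
theorem commutant_rotation (hN : ∀ h : TwoQubitGate, (h.1 ⊗ₖ h.1) * N = N * (h.1 ⊗ₖ h.1))
    {o e : BitString 2} (hoe : o ≠ e) :
    N (o, o) (o, o) = N (o, e) (o, e) + N (e, o) (o, e) := by
  have h1 := congrFun (congrFun (hN ⟨_, reflection_mem⟩) (o, o)) (o, e)
  have hz := commutant_phase hN
  rw [Matrix.mul_apply, Matrix.mul_apply] at h1
  have hl : ∀ p : BitString 2 × BitString 2, p ≠ (o, e) → p ≠ (e, o) → N p (o, e) = 0 := by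
    rintro ⟨c, c'⟩ h1 h2
    by_contra h3
    rcases hz _ _ _ _ h3 with ⟨rfl, rfl⟩ | ⟨rfl, rfl⟩
    · exact h1 rfl
    · exact h2 rfl
  have hr : ∀ p : BitString 2 × BitString 2, p ≠ (o, o) → N (o, o) p = 0 := by
    rintro ⟨c, c'⟩ h1
    by_contra h3
    rcases hz _ _ _ _ h3 with ⟨rfl, rfl⟩ | ⟨rfl, rfl⟩
    · exact h1 rfl
    · exact h1 rfl
  rw [Finset.sum_eq_add (o, e) (e, o) (fun h => hoe (Prod.ext_iff.1 h).1)
    (fun c _ hc => by rw [hl c hc.1 hc.2, mul_zero]) (by simp) (by simp),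
    Finset.sum_eq_single (o, o) (fun c _ hc => by rw [hr c hc, zero_mul]) (by simp)] at h1
  simp only [Matrix.kroneckerMap_apply, Matrix.of_apply, if_true, if_neg hoe] at h1
  linear_combination 4 * h1

theorem exists_perm_pair {o e a a' : BitString 2} (hoe : o ≠ e) (ha : a ≠ a') :
    ∃ π : Equiv.Perm (BitString 2), π o = a ∧ π e = a' := by
  refine ⟨Equiv.swap o a |>.trans (Equiv.swap (Equiv.swap o a e) a'), ?_, ?_⟩
  · simp only [Equiv.trans_apply, Equiv.swap_apply_left]
    refine Equiv.swap_apply_of_ne_of_ne (fun h => hoe ?_) ha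
    exact (Equiv.swap o a).injective ((Equiv.swap_apply_left o a).trans h)
  · simp

/-- The commutant of `{h ⊗ h}` is spanned by the identity and the swap. -/
theorem commutant_eq (hN : ∀ h : TwoQubitGate, (h.1 ⊗ₖ h.1) * N = N * (h.1 ⊗ₖ h.1)) :
    ∃ q r : ℂ, ∀ a a' b b', N (a, a') (b, b') =
      (if a = b ∧ a' = b' then q else 0) + (if a = b' ∧ a' = b then r else 0) := by
  set o : BitString 2 := fun _ => 0
  set e : BitString 2 := fun _ => 1
  have hoe : o ≠ e := fun h => by simpa [o, e] using congrFun h 0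
  refine ⟨N (o, e) (o, e), N (e, o) (o, e), fun a a' b b' => ?_⟩
  have hz := commutant_phase hN a a' b b'
  by_cases h1 : a = b ∧ a' = b'
  · obtain ⟨rfl, rfl⟩ := h1
    by_cases h2 : a = a'
    · subst h2
      obtain ⟨π, h1, -⟩ := exists_perm_pair hoe (exists_ne a).choose_spec.symm
      simp only [and_self, if_true]
      rw [← commutant_rotation hN hoe, ← h1, commutant_perm hN]
    · obtain ⟨π, h3, h4⟩ := exists_perm_pair hoe h2
      rw [if_pos ⟨rfl, rfl⟩, if_neg (fun h => h2 h.1), add_zero, ← h3, ← h4, commutant_perm hN]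
  · by_cases h2 : a = b' ∧ a' = b
    · obtain ⟨rfl, rfl⟩ := h2
      have h3 : a' ≠ a := fun h => h1 ⟨h.symm, h⟩
      obtain ⟨π, h3, h4⟩ := exists_perm_pair hoe h3
      rw [if_neg h1, if_pos ⟨rfl, rfl⟩, zero_add, ← h3, ← h4, commutant_perm hN]
    · rw [if_neg h1, if_neg h2, add_zero]
      by_contra h3
      rcases hz h3 with h | h
      · exact h1 h
      · exact h2 h

end Commutant

/-- With coefficients `q` of the identity and `r` of the swap, the two conserved traces are `16 q +
4 r` and `4 q + 16 r`; the stated coefficients invert this system. -/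
theorem twirl_apply (M : Matrix (BitString 2 × BitString 2) (BitString 2 × BitString 2) ℂ)
    (a a' b b' : BitString 2) : twirl M (a, a') (b, b') =
      (if a = b ∧ a' = b' then (4 * M.trace - (swapTwo * M).trace) / 60 else 0) +
      (if a = b' ∧ a' = b then (4 * (swapTwo * M).trace - M.trace) / 60 else 0) := by
  obtain ⟨q, r, h⟩ := commutant_eq (fun h => kronecker_mul_twirl h M)
  have hc : ((Finset.univ : Finset (BitString 2)).card : ℂ) = 4 := by simp
  have hc2 : ((Finset.univ : Finset (BitString 2 × BitString 2)).card : ℂ) = 16 := by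
    rw [Finset.card_univ, Fintype.card_prod]; norm_num
  have h1 : M.trace = 16 * q + 4 * r := by
    rw [← trace_twirl M, Matrix.trace]
    simp only [Matrix.diag, Fintype.sum_prod_type, h, and_self, if_true, Finset.sum_add_distrib,
      Finset.sum_const, nsmul_eq_mul, hc2]
    have : ∀ a b : BitString 2, (a = b ∧ b = a) ↔ a = b := fun a b => ⟨fun h => h.1, fun h => ⟨h, h.symm⟩⟩
    simp only [this, Finset.sum_ite_eq, Finset.mem_univ, if_true, Finset.sum_const, nsmul_eq_mul, hc]
  have h2 : (swapTwo * M).trace = 4 * q + 16 * r := by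
    rw [← trace_swapTwo_mul_twirl M, Matrix.trace]
    simp only [Matrix.diag, swapTwo_mul_apply, Fintype.sum_prod_type, Prod.swap_prod_mk, h,
      and_self, if_true, Finset.sum_add_distrib, Finset.sum_const, nsmul_eq_mul, hc]
    have : ∀ a b : BitString 2, (b = a ∧ a = b) ↔ a = b := fun a b => ⟨fun h => h.2, fun h => ⟨h.symm, h⟩⟩
    simp only [this, Finset.sum_ite_eq, Finset.mem_univ, if_true, Finset.sum_const, nsmul_eq_mul, hc]
    ring
  rw [h, h1, h2]
  congr 2 <;> ring

/-- The operator of a pair of copies of a qubit: the normalized swap or identity. -/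
def siteTensor (c : Bool) (x x' y y' : Fin 2) : ℂ :=
  if c then (if x = y' ∧ x' = y then 1 / 2 else 0) else (if x = y ∧ x' = y' then 1 / 4 else 0)

theorem sum_sum_prod_eq {ι κ R : Type*} [Fintype ι] [DecidableEq ι] [Fintype κ] [CommSemiring R]
    (f : ι → κ → κ → R) :
    ∑ w : ι → κ, ∑ w' : ι → κ, ∏ t, f t (w t) (w' t) = ∏ t, ∑ x, ∑ x', f t x x' := by
  rw [← sum_prod_eq_prod_sum (fun t x => ∑ x', f t x x')]
  exact Finset.sum_congr rfl fun w _ => sum_prod_eq_prod_sum (fun t x' => f t (w t) x')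

theorem trace_siteTensor (c : Bool) : ∑ x, ∑ x', siteTensor c x x' x x' = 1 := by
  cases c <;> norm_num [siteTensor, Fin.sum_univ_two]

theorem swap_trace_siteTensor (c : Bool) :
    ∑ x, ∑ x', siteTensor c x' x x x' = (spinWeight c : ℂ) := by
  cases c <;> norm_num [siteTensor, Fin.sum_univ_two, spinWeight]

theorem prod_siteTensor (c : Bool) (a a' b b' : BitString 2) :
    ∏ t, siteTensor c (a t) (a' t) (b t) (b' t) =
      if c then (if a = b' ∧ a' = b then 1 / 4 else 0)
        else (if a = b ∧ a' = b' then 1 / 16 else 0) := by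
  have h : ∀ p q r s : Prop, ((p ∧ q) ∧ (r ∧ s)) ↔ ((p ∧ r) ∧ (q ∧ s)) := by tauto
  cases c <;> simp only [siteTensor, Fin.prod_univ_two, funext_iff, Fin.forall_fin_two,
    Bool.false_eq_true, if_false, if_true, ite_mul, mul_ite, mul_zero, zero_mul, ← ite_and] <;>
  · congr 1
    · rw [h]; exact propext (by tauto)
    · norm_num

/-- On two qubits the normalized swap and identity have swap traces `4` and `1/4`, and a mixed input
has `1`. Writing `1` as an average of `4` and `1/4` puts probability `1/5` on the swap. -/
theorem twirl_siteTensor (s : Fin 2 → Bool) (a a' b b' : BitString 2) :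
    twirl (Matrix.of fun p q => ∏ t, siteTensor (s t) (p.1 t) (p.2 t) (q.1 t) (q.2 t))
        (a, a') (b, b') =
      ∑ c, (gateKernel (s 0) (s 1) c : ℂ) * ∏ t, siteTensor c (a t) (a' t) (b t) (b' t) := by
  rw [twirl_apply]
  have h1 : (Matrix.of fun p q : BitString 2 × BitString 2 =>
      ∏ t, siteTensor (s t) (p.1 t) (p.2 t) (q.1 t) (q.2 t)).trace = 1 := by
    simp only [Matrix.trace, Matrix.diag, Matrix.of_apply, Fintype.sum_prod_type]
    rw [sum_sum_prod_eq (fun t x x' => siteTensor (s t) x x' x x')]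
    exact Finset.prod_eq_one fun t _ => trace_siteTensor _
  have h2 : (swapTwo * (Matrix.of fun p q : BitString 2 × BitString 2 =>
      ∏ t, siteTensor (s t) (p.1 t) (p.2 t) (q.1 t) (q.2 t))).trace =
      spinWeight (s 0) * spinWeight (s 1) := by
    simp only [Matrix.trace, Matrix.diag, swapTwo_mul_apply, Matrix.of_apply,
      Fintype.sum_prod_type, Prod.fst_swap, Prod.snd_swap]
    rw [sum_sum_prod_eq (fun t x x' => siteTensor (s t) x' x x x')]
    simp only [swap_trace_siteTensor, Fin.prod_univ_two]
  rw [h1, h2]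
  simp only [prod_siteTensor, Fintype.sum_bool]
  by_cases e1 : a = b ∧ a' = b' <;> by_cases e2 : a = b' ∧ a' = b <;>
  cases s 0 <;> cases s 1 <;> simp [e1, e2, gateKernel, spinWeight] <;> norm_num <;> ring

/-- Two copies of a pure state have trace and swap trace `1`, just like a mixed pair of spins, hence
the same weights. -/
theorem twirl_zero (a a' b b' : BitString 2) :
    twirl (Matrix.of fun p q => if p = 0 ∧ q = 0 then 1 else 0) (a, a') (b, b') =
      ∑ c, (initialSpin c : ℂ) * ∏ t, siteTensor c (a t) (a' t) (b t) (b' t) := by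
  rw [twirl_apply]
  have h1 : (Matrix.of fun p q : BitString 2 × BitString 2 =>
      if p = 0 ∧ q = 0 then (1 : ℂ) else 0).trace = 1 := by
    simp [Matrix.trace]
  have h2 : (swapTwo * (Matrix.of fun p q : BitString 2 × BitString 2 =>
      if p = 0 ∧ q = 0 then (1 : ℂ) else 0)).trace = 1 := by
    simp only [Matrix.trace, Matrix.diag, swapTwo_mul_apply, Matrix.of_apply]
    rw [Finset.sum_eq_single 0]
    · simp
    · intro b _ hb
      simp [hb]
    · simp
  rw [h1, h2]
  simp only [prod_siteTensor, Fintype.sum_bool]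
  by_cases e1 : a = b ∧ a' = b' <;> by_cases e2 : a = b' ∧ a' = b <;>
    simp [e1, e2, initialSpin] <;> norm_num <;> ring

/-! ### The second moments of brickwork circuits -/

instance instIsProbabilityMeasureRandomGates (m d : ℕ) :
    IsProbabilityMeasure (randomGates m d) := by
  unfold randomGates; infer_instance

theorem integral_randomGates_succ {E : Type*} [NormedAddCommGroup E] [NormedSpace ℝ E] (m d : ℕ)
    (F : (Fin m → TwoQubitGate) × CircuitGates m d → E) :
    ∫ g, F (g (Fin.last d), fun k => g k.castSucc) ∂randomGates m (d + 1) =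
      ∫ p, F p ∂((Measure.pi fun _ : Fin m => haarU4).prod (randomGates m d)) := by
  have h := measurePreserving_piFinSuccAbove
    (fun _ : Fin (d + 1) => (Measure.pi fun _ : Fin m => haarU4)) (Fin.last d)
  rw [randomGates, randomGates, ← h.integral_comp']
  simp [MeasurableEquiv.piFinSuccAbove, Fin.insertNthEquiv]
  rfl

theorem integral_sum₄ {α ι : Type*} [Fintype ι] [MeasurableSpace α] {μ : Measure α}
    {f : ι → ι → ι → ι → α → ℂ} (hf : ∀ v v' w w', Integrable (f v v' w w') μ) :
    ∫ x, ∑ v, ∑ v', ∑ w, ∑ w', f v v' w w' x ∂μ =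
      ∑ v, ∑ v', ∑ w, ∑ w', ∫ x, f v v' w w' x ∂μ := by
  rw [integral_finsetSum _ fun v _ => integrable_finsetSum _ fun v' _ =>
    integrable_finsetSum _ fun w _ => integrable_finsetSum _ fun w' _ => hf _ _ _ _]
  refine Finset.sum_congr rfl fun v _ => ?_
  rw [integral_finsetSum _ fun v' _ =>
    integrable_finsetSum _ fun w _ => integrable_finsetSum _ fun w' _ => hf _ _ _ _]
  refine Finset.sum_congr rfl fun v' _ => ?_
  rw [integral_finsetSum _ fun w _ => integrable_finsetSum _ fun w' _ => hf _ _ _ _]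
  refine Finset.sum_congr rfl fun w _ => ?_
  rw [integral_finsetSum _ fun w' _ => hf _ _ _ _]

theorem sum₄_prod_eq {ι κ R : Type*} [Fintype ι] [DecidableEq ι] [Fintype κ] [CommSemiring R]
    (f : ι → κ → κ → κ → κ → R) :
    ∑ v : ι → κ, ∑ v' : ι → κ, ∑ w : ι → κ, ∑ w' : ι → κ, ∏ t, f t (v t) (v' t) (w t) (w' t) =
      ∏ t, ∑ v, ∑ v', ∑ w, ∑ w', f t v v' w w' := by
  rw [← sum_sum_prod_eq (fun t v v' => ∑ w, ∑ w', f t v v' w w')]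
  exact Finset.sum_congr rfl fun v _ => Finset.sum_congr rfl fun v' _ =>
    sum_sum_prod_eq (fun t w w' => f t (v t) (v' t) w w')

theorem mul_sum₄ {ι R : Type*} [Fintype ι] [CommSemiring R] (A B C D : ι → R) :
    (∑ w, A w) * (∑ w', B w') * (∑ v, C v) * (∑ v', D v') =
      ∑ v, ∑ v', ∑ w, ∑ w', A w * B w' * C v * D v' := by
  simp only [← Finset.sum_mul, ← Finset.mul_sum]

theorem continuous_layerMatrix_apply (m k : ℕ) (x y : BitString (m * 2)) :
    Continuous fun G : Fin m → TwoQubitGate => layerMatrix m k G x y :=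
  continuous_finsetProd _ fun j _ => (continuous_gate_apply _ _).comp (continuous_apply j)

/-- The amplitudes of the output state of a brickwork circuit. -/
def amplitude (m d : ℕ) (g : CircuitGates m d) (x : BitString (m * 2)) : ℂ :=
  (brickwork m d g).1 x 0

theorem amplitude_succ (m d : ℕ) (g : CircuitGates m (d + 1)) (x : BitString (m * 2)) :
    amplitude m (d + 1) g x =
      ∑ w, layerMatrix m d (g (Fin.last d)) x w * amplitude m d (fun k => g k.castSucc) w := by
  simp [amplitude, brickwork, layer, Matrix.mul_apply]

theorem continuous_amplitude (m d : ℕ) (x : BitString (m * 2)) :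
    Continuous fun g : CircuitGates m d => amplitude m d g x := by
  induction d generalizing x with
  | zero => exact continuous_const
  | succ d ih =>
    simp only [amplitude_succ]
    refine continuous_finsetSum _ fun w _ => ?_
    refine ((continuous_layerMatrix_apply m d x w).comp (continuous_apply (Fin.last d))).mul
      ((ih w).comp ?_)
    exact continuous_pi fun k => continuous_apply k.castSucc

/-- The second moments of the amplitudes. -/
def secondMoment (m d : ℕ) (x x' y y' : BitString (m * 2)) : ℂ :=
  ∫ g, amplitude m d g x * amplitude m d g x' * star (amplitude m d g y) *
    star (amplitude m d g y') ∂randomGates m d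

/-- The second moments of the entries of a Haar random gate. -/
def gateMoment (a a' b b' w w' v v' : BitString 2) : ℂ :=
  ∫ g : TwoQubitGate, g.1 a w * g.1 a' w' * star (g.1 b v) * star (g.1 b' v') ∂haarU4

theorem sum_gateMoment_mul
    (M : Matrix (BitString 2 × BitString 2) (BitString 2 × BitString 2) ℂ)
    (a a' b b' : BitString 2) : ∑ v, ∑ v', ∑ w, ∑ w',
      gateMoment a a' b b' w w' v v' * M (w, w') (v, v') = twirl M (a, a') (b, b') := by
  simp only [twirl, Matrix.of_apply, conjTwo_apply]
  rw [integral_sum₄]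
  · simp only [integral_mul_const, gateMoment]
  · intro v v' w w'
    refine integrable_of_continuous ?_
    exact ((((continuous_gate_apply a w).mul (continuous_gate_apply a' w')).mul
      (continuous_star.comp (continuous_gate_apply b v))).mul
      (continuous_star.comp (continuous_gate_apply b' v'))).mul continuous_const

theorem integral_layerMatrix (m k : ℕ) (x x' y y' w w' v v' : BitString (m * 2)) :
    ∫ G : Fin m → TwoQubitGate, layerMatrix m k G x w * layerMatrix m k G x' w' *
      star (layerMatrix m k G y v) * star (layerMatrix m k G y' v')
        ∂(Measure.pi fun _ : Fin m => haarU4) =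
    ∏ j, gateMoment (splitBits m k x j) (splitBits m k x' j) (splitBits m k y j)
      (splitBits m k y' j) (splitBits m k w j) (splitBits m k w' j) (splitBits m k v j)
      (splitBits m k v' j) := by
  simp only [gateMoment]
  rw [← integral_fintype_prod_eq_prod]
  simp only [layerMatrix, star_prod, ← Finset.prod_mul_distrib]
  rfl

theorem secondMoment_succ (m d : ℕ) (x x' y y' : BitString (m * 2)) :
    secondMoment m (d + 1) x x' y y' = ∑ v, ∑ v', ∑ w, ∑ w',
      (∏ j, gateMoment (splitBits m d x j) (splitBits m d x' j) (splitBits m d y j)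
        (splitBits m d y' j) (splitBits m d w j) (splitBits m d w' j) (splitBits m d v j)
        (splitBits m d v' j)) * secondMoment m d w w' v v' := by
  set F : (Fin m → TwoQubitGate) × CircuitGates m d → ℂ := fun p =>
    ∑ v, ∑ v', ∑ w, ∑ w', (layerMatrix m d p.1 x w * layerMatrix m d p.1 x' w' *
      star (layerMatrix m d p.1 y v) * star (layerMatrix m d p.1 y' v')) *
      (amplitude m d p.2 w * amplitude m d p.2 w' * star (amplitude m d p.2 v) *
        star (amplitude m d p.2 v')) with hF
  have h1 : ∀ g : CircuitGates m (d + 1),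
      amplitude m (d + 1) g x * amplitude m (d + 1) g x' * star (amplitude m (d + 1) g y) *
        star (amplitude m (d + 1) g y') = F (g (Fin.last d), fun k => g k.castSucc) := by
    intro g
    simp only [amplitude_succ, star_sum, hF]
    rw [mul_sum₄]
    refine Finset.sum_congr rfl fun v _ => Finset.sum_congr rfl fun v' _ =>
      Finset.sum_congr rfl fun w _ => Finset.sum_congr rfl fun w' _ => ?_
    simp only [star_mul']
    ring
  refine (integral_congr_ae (ae_of_all _ h1)).trans ((integral_randomGates_succ m d F).trans ?_)
  rw [hF, integral_sum₄]
  · refine Finset.sum_congr rfl fun v _ => Finset.sum_congr rfl fun v' _ =>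
      Finset.sum_congr rfl fun w _ => Finset.sum_congr rfl fun w' _ => ?_
    rw [integral_prod_mul (fun G : Fin m → TwoQubitGate => layerMatrix m d G x w *
      layerMatrix m d G x' w' * star (layerMatrix m d G y v) * star (layerMatrix m d G y' v'))
      (fun g => amplitude m d g w * amplitude m d g w' * star (amplitude m d g v) *
          star (amplitude m d g v')), integral_layerMatrix, secondMoment]
  · intro v v' w w'
    have hL := continuous_layerMatrix_apply m d
    have hA := continuous_amplitude m d
    refine Continuous.integrable_of_hasCompactSupport ?_ (HasCompactSupport.of_compactSpace _)
    exact (((((hL x w).comp continuous_fst).mul ((hL x' w').comp continuous_fst)).mul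
      (continuous_star.comp ((hL y v).comp continuous_fst))).mul
      (continuous_star.comp ((hL y' v').comp continuous_fst))).mul
      (((((hA w).comp continuous_snd).mul ((hA w').comp continuous_snd)).mul
      (continuous_star.comp ((hA v).comp continuous_snd))).mul
      (continuous_star.comp ((hA v').comp continuous_snd)))

theorem sum_gateMoment_prod (m k : ℕ)
    (M : Fin m → Matrix (BitString 2 × BitString 2) (BitString 2 × BitString 2) ℂ)
    (x x' y y' : BitString (m * 2)) :
    ∑ v, ∑ v', ∑ w, ∑ w',
      (∏ j, gateMoment (splitBits m k x j) (splitBits m k x' j) (splitBits m k y j)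
        (splitBits m k y' j) (splitBits m k w j) (splitBits m k w' j) (splitBits m k v j)
        (splitBits m k v' j)) *
      ∏ j, M j (splitBits m k w j, splitBits m k w' j) (splitBits m k v j, splitBits m k v' j) =
    ∏ j, twirl (M j) (splitBits m k x j, splitBits m k x' j)
      (splitBits m k y j, splitBits m k y' j) := by
  simp only [← sum_gateMoment_mul, ← Finset.prod_mul_distrib]
  rw [← sum₄_prod_eq (fun j v v' w w' => gateMoment (splitBits m k x j) (splitBits m k x' j)
    (splitBits m k y j) (splitBits m k y' j) w w' v v' * M j (w, w') (v, v'))]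
  set F : (Fin m → BitString 2) → (Fin m → BitString 2) → (Fin m → BitString 2) →
      (Fin m → BitString 2) → ℂ := fun v v' w w' =>
    ∏ j, (gateMoment (splitBits m k x j) (splitBits m k x' j)
    (splitBits m k y j) (splitBits m k y' j) (w j) (w' j) (v j) (v' j) *
      M j (w j, w' j) (v j, v' j)) with hF
  change ∑ v, ∑ v', ∑ w, ∑ w', F (splitBits m k v) (splitBits m k v') (splitBits m k w)
    (splitBits m k w') = ∑ v, ∑ v', ∑ w, ∑ w', F v v' w w'
  rw [← (splitBits m k).sum_comp]
  refine Finset.sum_congr rfl fun v _ => ?_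
  rw [← (splitBits m k).sum_comp]
  refine Finset.sum_congr rfl fun v' _ => ?_
  rw [← (splitBits m k).sum_comp]
  refine Finset.sum_congr rfl fun w _ => ?_
  rw [← (splitBits m k).sum_comp]

/-! ### How consecutive layers share qubits. -/

theorem val_finRotate (n : ℕ) (i : Fin n) : (finRotate n i : ℕ) = (i + 1) % n := by
  cases n with
  | zero => exact i.elim0
  | succ n =>
    rw [finRotate_apply, Fin.val_add]
    simp

theorem finRotate_finProdFinEquiv_zero (m : ℕ) (j : Fin m) :
    finRotate (m * 2) (finProdFinEquiv (j, 0)) = finProdFinEquiv (j, (1 : Fin 2)) := by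
  ext
  have := j.2
  rw [val_finRotate, finProdFinEquiv_apply_val, finProdFinEquiv_apply_val, Nat.mod_eq_of_lt]
  · simp; omega
  · simp; omega

theorem finRotate_finProdFinEquiv_one (m : ℕ) (j : Fin m) :
    finRotate (m * 2) (finProdFinEquiv (j, 1)) = finProdFinEquiv (finRotate m j, (0 : Fin 2)) := by
  ext
  rw [val_finRotate, finProdFinEquiv_apply_val, finProdFinEquiv_apply_val, val_finRotate]
  simp only [Fin.val_one, Fin.val_zero, zero_add]
  rw [← Nat.mul_mod_mul_left, mul_comm 2 m]
  congr 1
  ring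

theorem pairing_succ_zero (m k : ℕ) (j : Fin m) :
    pairing m (k + 1) (j, 0) = pairing m k (leftPair m k j, 1) := by
  by_cases h : Even k
  · simp [pairing, leftPair, h, Nat.even_add_one, -finRotate_apply, finRotate_finProdFinEquiv_zero]
  · simp only [pairing, leftPair, h, Nat.even_add_one, not_false_eq_true, if_true, if_false,
      Equiv.trans_apply, finRotate_finProdFinEquiv_one]
    rw [← Equiv.Perm.mul_apply, mul_inv_cancel, Equiv.Perm.one_apply]

theorem pairing_succ_one (m k : ℕ) (j : Fin m) :
    pairing m (k + 1) (j, 1) = pairing m k (rightPair m k j, 0) := by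
  by_cases h : Even k
  · simp [pairing, rightPair, h, Nat.even_add_one, -finRotate_apply, finRotate_finProdFinEquiv_one]
  · simp [pairing, rightPair, h, Nat.even_add_one, -finRotate_apply, finRotate_finProdFinEquiv_zero]

/-- The tensor product of the normalized identities and swaps given by the spins `c`. -/
def spinTensor (m k : ℕ) (c : Fin m → Bool) (x x' y y' : BitString (m * 2)) : ℂ :=
  ∏ j, ∏ t, siteTensor (c j) (x (pairing m k (j, t))) (x' (pairing m k (j, t)))
    (y (pairing m k (j, t))) (y' (pairing m k (j, t)))

/-- Regrouping by the pairs of the next layer: each spin hands its second qubit to one gate, where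
it comes first, and its first qubit to another, where it comes second. -/
theorem spinTensor_eq_succ (m k : ℕ) (c : Fin m → Bool) (x x' y y' : BitString (m * 2)) :
    spinTensor m k c x x' y y' = ∏ j, ∏ t : Fin 2,
      siteTensor (![c (leftPair m k j), c (rightPair m k j)] t)
        (splitBits m (k + 1) x j t) (splitBits m (k + 1) x' j t)
        (splitBits m (k + 1) y j t) (splitBits m (k + 1) y' j t) := by
  have hs : ∀ (z : BitString (m * 2)) (j : Fin m) (t : Fin 2),
      splitBits m (k + 1) z j t = z (pairing m (k + 1) (j, t)) := fun _ _ _ => rfl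
  simp only [spinTensor, hs, Fin.prod_univ_two, pairing_succ_zero, pairing_succ_one,
    Finset.prod_mul_distrib, Matrix.cons_val_zero, Matrix.cons_val_one]
  rw [Equiv.prod_comp (leftPair m k) (fun j => siteTensor (c j) (x (pairing m k (j, 1)))
    (x' (pairing m k (j, 1))) (y (pairing m k (j, 1))) (y' (pairing m k (j, 1)))),
    Equiv.prod_comp (rightPair m k) (fun j => siteTensor (c j) (x (pairing m k (j, 0)))
    (x' (pairing m k (j, 0))) (y (pairing m k (j, 0))) (y' (pairing m k (j, 0))))]
  exact mul_comm _ _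

theorem prod_sum_eq_sum_spinTensor (m k : ℕ) (f : Fin m → Bool → ℝ)
    (x x' y y' : BitString (m * 2)) :
    ∏ j, ∑ c, (f j c : ℂ) * ∏ t, siteTensor c (splitBits m k x j t) (splitBits m k x' j t)
      (splitBits m k y j t) (splitBits m k y' j t) =
    ∑ c : Fin m → Bool, ((∏ j, f j (c j) : ℝ) : ℂ) * spinTensor m k c x x' y y' := by
  rw [← sum_prod_eq_prod_sum]
  refine Finset.sum_congr rfl fun c _ => ?_
  rw [Finset.prod_mul_distrib]
  push_cast
  rfl

theorem secondMoment_zero (m : ℕ) (x x' y y' : BitString (m * 2)) :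
    secondMoment m 0 x x' y y' = ∏ j, (Matrix.of fun p q : BitString 2 × BitString 2 =>
      if p = 0 ∧ q = 0 then (1 : ℂ) else 0) (splitBits m 0 x j, splitBits m 0 x' j)
        (splitBits m 0 y j, splitBits m 0 y' j) := by
  have h0 : ∀ z : BitString (m * 2), z = 0 ↔ ∀ j, splitBits m 0 z j = 0 := by
    intro z
    rw [← (splitBits m 0).injective.eq_iff, funext_iff]
    rfl
  simp only [secondMoment, amplitude, brickwork, OneMemClass.coe_one, Matrix.one_apply,
    integral_const, probReal_univ, one_smul, Matrix.of_apply, Prod.mk_eq_zero]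
  rw [Finset.prod_ite_zero]
  simp only [apply_ite star, star_one, star_zero, ← ite_and, mul_ite, mul_one, mul_zero,
    Finset.prod_const_one, h0]
  congr 1
  simp only [Finset.mem_univ, forall_true_left, forall_and, eq_iff_iff]
  tauto

/-- Layers are independent, so each one twirls the average left by its predecessors, gate by gate.
The first layer only creates the initial law, so depth `k + 1` corresponds to `k` steps of the
chain. -/
theorem secondMoment_eq (m k : ℕ) (x x' y y' : BitString (m * 2)) :
    secondMoment m (k + 1) x x' y y' =
      ∑ c, (spinLaw m k c : ℂ) * spinTensor m k c x x' y y' := by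
  induction k generalizing x x' y y' with
  | zero =>
    rw [secondMoment_succ]
    simp only [secondMoment_zero]
    rw [sum_gateMoment_prod m 0 (fun _ => Matrix.of fun p q : BitString 2 × BitString 2 =>
      if p = 0 ∧ q = 0 then (1 : ℂ) else 0)]
    simp only [twirl_zero]
    rw [prod_sum_eq_sum_spinTensor m 0 (fun _ => initialSpin)]
    rfl
  | succ k ih =>
    rw [secondMoment_succ]
    simp only [ih]
    have hpull : ∀ (A : BitString (m * 2) → BitString (m * 2) → BitString (m * 2) →
        BitString (m * 2) → ℂ) (T : (Fin m → Bool) → BitString (m * 2) → BitString (m * 2) →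
        BitString (m * 2) → BitString (m * 2) → ℂ) (ω : (Fin m → Bool) → ℂ),
        ∑ v, ∑ v', ∑ w, ∑ w', A v v' w w' * ∑ c, ω c * T c v v' w w' =
          ∑ c, ω c * ∑ v, ∑ v', ∑ w, ∑ w', A v v' w w' * T c v v' w w' := by
      intro A T ω
      simp only [Finset.mul_sum]
      symm
      rw [Finset.sum_comm]
      refine Finset.sum_congr rfl fun v _ => ?_
      rw [Finset.sum_comm]
      refine Finset.sum_congr rfl fun v' _ => ?_
      rw [Finset.sum_comm]
      refine Finset.sum_congr rfl fun w _ => ?_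
      rw [Finset.sum_comm]
      exact Finset.sum_congr rfl fun w' _ => Finset.sum_congr rfl fun c _ => by ring
    rw [hpull _ (fun c v v' w w' => spinTensor m k c w w' v v') (fun c => spinLaw m k c)]
    have hc : ∀ c : Fin m → Bool, ∑ v, ∑ v', ∑ w, ∑ w',
        (∏ j, gateMoment (splitBits m (k + 1) x j) (splitBits m (k + 1) x' j)
          (splitBits m (k + 1) y j) (splitBits m (k + 1) y' j) (splitBits m (k + 1) w j)
          (splitBits m (k + 1) w' j) (splitBits m (k + 1) v j) (splitBits m (k + 1) v' j)) *
          spinTensor m k c w w' v v' =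
        ∑ c' : Fin m → Bool, ((∏ j, gateKernel (c (leftPair m k j)) (c (rightPair m k j)) (c' j) :
          ℝ) : ℂ) * spinTensor m (k + 1) c' x x' y y' := by
      intro c
      simp only [spinTensor_eq_succ m k]
      refine (sum_gateMoment_prod m (k + 1) (fun j => Matrix.of fun p q => ∏ t : Fin 2,
        siteTensor (![c (leftPair m k j), c (rightPair m k j)] t) (p.1 t) (p.2 t) (q.1 t)
          (q.2 t)) x x' y y').trans ?_
      simp only [twirl_siteTensor, Matrix.cons_val_zero, Matrix.cons_val_one]
      exact prod_sum_eq_sum_spinTensor m (k + 1)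
        (fun j => gateKernel (c (leftPair m k j)) (c (rightPair m k j))) x x' y y'
    simp only [hc, spinLaw, Finset.mul_sum]
    rw [Finset.sum_comm]
    refine Finset.sum_congr rfl fun c' _ => ?_
    push_cast
    rw [Finset.sum_mul]
    exact Finset.sum_congr rfl fun c _ => by ring

/-! ### From second moments to the variance of a query. -/

/-- The overlap of a pair of measured qubits with the normalized identity or swap. -/
def siteOverlap (c : Bool) (x y : Fin 2) : ℝ :=
  if c then (if x = y then 1 / 2 else 0) else 1 / 4

/-- The overlap of a pair of outcomes with a tensor product of identities and swaps. -/
def spinOverlap (m k : ℕ) (c : Fin m → Bool) (x y : BitString (m * 2)) : ℝ :=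
  ∏ j, ∏ t, siteOverlap (c j) (x (pairing m k (j, t))) (y (pairing m k (j, t)))

theorem spinTensor_diag (m k : ℕ) (c : Fin m → Bool) (x y : BitString (m * 2)) :
    spinTensor m k c x y x y = spinOverlap m k c x y := by
  have : ∀ (c : Bool) (u v : Fin 2), siteTensor c u v u v = (siteOverlap c u v : ℂ) := by
    intro c u v
    cases c <;> by_cases h : u = v <;> simp [siteTensor, siteOverlap, h, eq_comm]
  simp only [spinTensor, spinOverlap, this]
  push_cast
  rfl

theorem spinOverlap_nonneg (m k : ℕ) (c : Fin m → Bool) (x y : BitString (m * 2)) :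
    0 ≤ spinOverlap m k c x y :=
  Finset.prod_nonneg fun _ _ => Finset.prod_nonneg fun _ _ => by
    unfold siteOverlap; split_ifs <;> norm_num

theorem spinOverlap_comm (m k : ℕ) (c : Fin m → Bool) (x y : BitString (m * 2)) :
    spinOverlap m k c x y = spinOverlap m k c y x := by
  simp only [spinOverlap, siteOverlap, eq_comm]

/-- The row sums do not depend on the spins, which allows one Schur test for all configurations. -/
theorem sum_spinOverlap (m k : ℕ) (c : Fin m → Bool) (x : BitString (m * 2)) :
    ∑ y, spinOverlap m k c x y = (1 / 4) ^ m := by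
  have h1 : ∀ y, spinOverlap m k c x y =
      ∏ j, ∏ t, siteOverlap (c j) (splitBits m k x j t) (splitBits m k y j t) := fun y => rfl
  simp only [h1]
  rw [(splitBits m k).sum_comp
    (fun y => ∏ j, ∏ t, siteOverlap (c j) (splitBits m k x j t) (y j t)),
    sum_prod_eq_prod_sum (fun j (y : BitString 2) =>
      ∏ t, siteOverlap (c j) (splitBits m k x j t) (y t))]
  have h2 : ∀ j, ∑ y : BitString 2, ∏ t, siteOverlap (c j) (splitBits m k x j t) (y t) = 1 / 4 := by
    intro j
    rw [sum_prod_eq_prod_sum (fun t v => siteOverlap (c j) (splitBits m k x j t) v)]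
    have h3 : ∀ (c : Bool) (u : Fin 2), ∑ v, siteOverlap c u v = 1 / 2 := by
      intro c u
      cases c
      · norm_num [siteOverlap]
      · simp [siteOverlap]
    simp only [h3]
    norm_num
  rw [Finset.prod_congr rfl fun j _ => h2 j]
  simp

theorem spinOverlap_false (m k : ℕ) (x y : BitString (m * 2)) :
    spinOverlap m k (fun _ => false) x y = (1 / 16) ^ m := by
  simp only [spinOverlap, siteOverlap, Bool.false_eq_true, if_false, Finset.prod_const,
    Finset.card_univ, Fintype.card_fin]
  norm_num

theorem continuous_born (m d : ℕ) (x : BitString (m * 2)) :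
    Continuous fun g : CircuitGates m d => (born (brickwork m d g)).1 x :=
  (continuous_amplitude m d x).norm.pow 2

theorem integral_born_mul_born (m k : ℕ) (x y : BitString (m * 2)) :
    ∫ g, (born (brickwork m (k + 1) g)).1 x * (born (brickwork m (k + 1) g)).1 y
      ∂randomGates m (k + 1) = ∑ c, spinLaw m k c * spinOverlap m k c x y := by
  have h : ∀ g, (((born (brickwork m (k + 1) g)).1 x * (born (brickwork m (k + 1) g)).1 y : ℝ) : ℂ)
      = amplitude m (k + 1) g x * amplitude m (k + 1) g y * star (amplitude m (k + 1) g x) *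
        star (amplitude m (k + 1) g y) := by
    intro g
    have h2 : ∀ z, (((born (brickwork m (k + 1) g)).1 z : ℝ) : ℂ) =
        amplitude m (k + 1) g z * star (amplitude m (k + 1) g z) := fun z => by
      have := Complex.mul_conj' (amplitude m (k + 1) g z)
      rw [Complex.star_def, this]
      simp [born, amplitude]
    rw [Complex.ofReal_mul, h2, h2]
    ring
  have h1 := secondMoment_eq m k x y x y
  rw [secondMoment, ← integral_congr_ae (ae_of_all _ h), integral_complex_ofReal] at h1
  simp only [spinTensor_diag] at h1
  exact_mod_cast h1

theorem continuous_expect (m d : ℕ) (φ : QueryFn (BitString (m * 2))) :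
    Continuous fun g : CircuitGates m d => expect (born (brickwork m d g)) φ :=
  continuous_finsetSum _ fun x _ => (continuous_born m d x).mul continuous_const

theorem integrable_of_continuous_circuit {m d : ℕ} {f : CircuitGates m d → ℝ}
    (hf : Continuous f) : Integrable f (randomGates m d) :=
  hf.integrable_of_hasCompactSupport (HasCompactSupport.of_compactSpace f)

/-- The expectation of a query under the uniform distribution. -/
def uniformExpect {n : ℕ} (φ : QueryFn (BitString n)) : ℝ :=
  (∑ x, (φ x : ℝ)) / 2 ^ n

/-- The centred query `f` has sum zero, which annihilates the constant overlap of the all-identity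
configuration. For the others, `f x * f y ≤ (f x ^ 2 + f y ^ 2) / 2` and the row sums `(1/4) ^ m`
balance `∑ f ^ 2 ≤ 4 ^ m`. -/
theorem integral_expect_sub_sq_le_sum (m k : ℕ) (φ : QueryFn (BitString (m * 2))) :
    ∫ g, (expect (born (brickwork m (k + 1) g)) φ - uniformExpect φ) ^ 2 ∂randomGates m (k + 1) ≤
      ∑ c, spinLaw m k c * (if c = fun _ => false then (0 : ℝ) else 1) := by
  set u := uniformExpect φ with hu
  set f : BitString (m * 2) → ℝ := fun x => φ x - u with hf
  have hcard : (Finset.univ : Finset (BitString (m * 2))).card = 2 ^ (m * 2) := by simp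
  have hfsum : ∑ x, f x = 0 := by
    simp only [hf, Finset.sum_sub_distrib, Finset.sum_const, hcard, nsmul_eq_mul, hu,
      uniformExpect]
    push_cast
    field_simp
    ring
  have hfsq : ∑ x, f x ^ 2 ≤ 4 ^ m := by
    have h1 : ∑ x, f x ^ 2 = ∑ x, (φ x : ℝ) ^ 2 - u ^ 2 * 2 ^ (m * 2) := by
      have h2 : ∀ x, f x ^ 2 = (φ x : ℝ) ^ 2 - u ^ 2 - 2 * u * f x := fun x => by
        simp only [hf]; ring
      simp only [h2]
      rw [Finset.sum_sub_distrib, Finset.sum_sub_distrib, ← Finset.mul_sum, hfsum,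
        Finset.sum_const, hcard, nsmul_eq_mul]
      push_cast
      ring
    have h3 : ∑ x, (φ x : ℝ) ^ 2 ≤ ∑ _x : BitString (m * 2), (1 : ℝ) :=
      Finset.sum_le_sum fun x _ => by
        have := (φ x).2
        rw [sq_le_one_iff_abs_le_one, abs_le]
        exact this
    rw [Finset.sum_const, hcard, nsmul_eq_mul] at h3
    have h4 : (2 : ℝ) ^ (m * 2) = 4 ^ m := by rw [mul_comm, pow_mul]; norm_num
    push_cast at h3
    have : 0 ≤ u ^ 2 * 2 ^ (m * 2) := by positivity
    linarith
  have h1 : ∀ g : CircuitGates m (k + 1), (expect (born (brickwork m (k + 1) g)) φ - u) ^ 2 =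
      ∑ x, ∑ y, f x * f y *
        ((born (brickwork m (k + 1) g)).1 x * (born (brickwork m (k + 1) g)).1 y) := by
    intro g
    have h2 : expect (born (brickwork m (k + 1) g)) φ - u =
        ∑ x, f x * (born (brickwork m (k + 1) g)).1 x := by
      simp only [hf, sub_mul, Finset.sum_sub_distrib, ← Finset.mul_sum, expect]
      rw [(born (brickwork m (k + 1) g)).2.2, mul_one]
      simp only [mul_comm]
    rw [h2, sq, Finset.sum_mul_sum]
    exact Finset.sum_congr rfl fun x _ => Finset.sum_congr rfl fun y _ => by ring
  have hint : ∀ x y, Integrable (fun g : CircuitGates m (k + 1) => f x * f y *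
      ((born (brickwork m (k + 1) g)).1 x * (born (brickwork m (k + 1) g)).1 y))
      (randomGates m (k + 1)) := fun x y => integrable_of_continuous_circuit
    (continuous_const.mul ((continuous_born _ _ x).mul (continuous_born _ _ y)))
  simp only [h1]
  rw [integral_finsetSum _ fun x _ => integrable_finsetSum _ fun y _ => hint x y]
  simp only [integral_finsetSum _ fun y _ => hint _ y, integral_const_mul, integral_born_mul_born]
  have h2 : ∑ x, ∑ y, f x * f y * ∑ c, spinLaw m k c * spinOverlap m k c x y =
      ∑ c, spinLaw m k c * ∑ x, ∑ y, f x * f y * spinOverlap m k c x y := by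
    simp only [Finset.mul_sum]
    symm
    rw [Finset.sum_comm]
    refine Finset.sum_congr rfl fun x _ => ?_
    rw [Finset.sum_comm]
    exact Finset.sum_congr rfl fun y _ => Finset.sum_congr rfl fun c _ => by ring
  rw [h2]
  refine Finset.sum_le_sum fun c _ => mul_le_mul_of_nonneg_left ?_ (spinLaw_nonneg m k c)
  split_ifs with hc
  · subst hc
    simp only [spinOverlap_false, ← Finset.sum_mul, ← Finset.mul_sum, hfsum]
    simp
  · have hsum' : ∀ y, ∑ x, spinOverlap m k c x y = (1 / 4) ^ m := fun y => by
      simp only [spinOverlap_comm m k c _ y, sum_spinOverlap]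
    calc ∑ x, ∑ y, f x * f y * spinOverlap m k c x y
        ≤ ∑ x, ∑ y, (f x ^ 2 / 2 * spinOverlap m k c x y + f y ^ 2 / 2 * spinOverlap m k c x y) := by
          refine Finset.sum_le_sum fun x _ => Finset.sum_le_sum fun y _ => ?_
          rw [← add_mul]
          refine mul_le_mul_of_nonneg_right ?_ (spinOverlap_nonneg m k c x y)
          nlinarith [sq_nonneg (f x - f y)]
      _ = ∑ x, f x ^ 2 * (1 / 4) ^ m := by
          simp only [Finset.sum_add_distrib]
          rw [Finset.sum_comm (f := fun x y => f y ^ 2 / 2 * spinOverlap m k c x y)]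
          simp only [← Finset.mul_sum, sum_spinOverlap, hsum']
          rw [← Finset.sum_add_distrib]
          exact Finset.sum_congr rfl fun x _ => by ring
      _ ≤ 4 ^ m * (1 / 4) ^ m := by
          rw [← Finset.sum_mul]
          exact mul_le_mul_of_nonneg_right hfsq (by positivity)
      _ = 1 := by rw [← mul_pow]; norm_num

/-- The variance of the expectation of a query. -/
theorem integral_expect_sub_sq_le (m k : ℕ) (φ : QueryFn (BitString ((m + 1) * 2))) :
    ∫ g, (expect (born (brickwork (m + 1) (k + 1) g)) φ - uniformExpect φ) ^ 2
      ∂randomGates (m + 1) (k + 1) ≤ (1 / 4) ^ (m + 1) + ((1 + (4 / 5) ^ k) ^ m - 1) / 2 :=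
  (integral_expect_sub_sq_le_sum (m + 1) k φ).trans (sum_spinLaw_indicator_le m k)

/-! ### The standard complex Gaussian -/

/-- The standard complex Gaussian distribution. -/
def complexGaussian : Measure ℂ :=
  volume.withDensity fun z => ENNReal.ofReal (Real.exp (-‖z‖ ^ 2) / Real.pi)

theorem integral_complexGaussian (f : ℂ → ℝ) :
    ∫ z, f z ∂complexGaussian = ∫ z, Real.exp (-‖z‖ ^ 2) / Real.pi * f z := by
  rw [complexGaussian, integral_withDensity_eq_integral_toReal_smul]
  · refine integral_congr_ae (ae_of_all _ fun z => ?_)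
    simp only [smul_eq_mul]
    rw [ENNReal.toReal_ofReal (by positivity)]
  · exact ENNReal.measurable_ofReal.comp (by fun_prop)
  · exact ae_of_all _ fun _ => ENNReal.ofReal_lt_top

/-- Under the standard complex Gaussian, `‖z‖²` is exponentially distributed. -/
theorem integral_complexGaussian_norm_sq (f : ℝ → ℝ) :
    ∫ z, f (‖z‖ ^ 2) ∂complexGaussian = ∫ s in Set.Ioi (0 : ℝ), Real.exp (-s) * f s := by
  rw [integral_complexGaussian, integral_fun_norm_addHaar (volume : Measure ℂ)
    (fun r => Real.exp (-r ^ 2) / Real.pi * f (r ^ 2)),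
    ← integral_comp_rpow_Ioi_of_pos (g := fun s => Real.exp (-s) * f s) two_pos]
  have h1 : (volume : Measure ℂ).real (Metric.ball 0 1) = Real.pi := by
    simp [Measure.real, Complex.volume_ball]
  rw [h1, Complex.finrank_real_complex, ← integral_smul, nsmul_eq_mul, ← integral_const_mul]
  refine setIntegral_congr_fun measurableSet_Ioi fun r hr => ?_
  have hr' : (0 : ℝ) < r := hr
  have : Real.pi ≠ 0 := Real.pi_ne_zero
  simp only [smul_eq_mul, Real.rpow_two, show (2 : ℝ) - 1 = 1 by norm_num, Real.rpow_one,
    show 2 - 1 = 1 from rfl, pow_one]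
  push_cast
  field_simp

theorem integrableOn_exp_neg : IntegrableOn (fun s : ℝ => Real.exp (-s)) (Set.Ioi 0) := by
  simpa using integrableOn_exp_neg_Ioi 0

theorem integral_exp_neg_Ioi_eq_one : ∫ s in Set.Ioi (0 : ℝ), Real.exp (-s) = 1 := by
  rw [integral_exp_neg_Ioi]; simp

theorem integral_exp_neg_mul_self : ∫ s in Set.Ioi (0 : ℝ), Real.exp (-s) * s = 1 := by
  have := Real.Gamma_eq_integral (s := 2) two_pos
  rw [Real.Gamma_two] at this
  rw [this]
  refine setIntegral_congr_fun measurableSet_Ioi fun r _ => ?_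
  norm_num

theorem integrableOn_exp_neg_mul_self :
    IntegrableOn (fun s : ℝ => Real.exp (-s) * s) (Set.Ioi 0) := by
  -- A non-integrable function has integral `0` by convention, whereas this integral is `1`.
  by_contra h
  have := integral_undef h
  rw [integral_exp_neg_mul_self] at this
  exact one_ne_zero this

instance : IsProbabilityMeasure complexGaussian := by
  have h1 : ∫ z : ℂ, Real.exp (-‖z‖ ^ 2) / Real.pi = 1 := by
    have h := integral_complexGaussian_norm_sq fun _ => 1
    rw [integral_complexGaussian] at h
    simpa only [mul_one, integral_exp_neg_Ioi_eq_one] using h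
  have h2 : Integrable fun z : ℂ => Real.exp (-‖z‖ ^ 2) / Real.pi := by
    by_contra h
    rw [integral_undef h] at h1
    exact zero_ne_one h1
  refine ⟨?_⟩
  rw [complexGaussian, withDensity_apply _ MeasurableSet.univ, Measure.restrict_univ,
    ← ofReal_integral_eq_lintegral_ofReal h2 (ae_of_all _ fun z => by positivity), h1,
    ENNReal.ofReal_one]

theorem integral_norm_sq_complexGaussian : ∫ z, ‖z‖ ^ 2 ∂complexGaussian = 1 := by
  rw [integral_complexGaussian_norm_sq (fun s => s), integral_exp_neg_mul_self]

theorem integrable_norm_sq_complexGaussian : Integrable (fun z => ‖z‖ ^ 2) complexGaussian := by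
  by_contra h
  have := integral_undef h
  rw [integral_norm_sq_complexGaussian] at this
  exact one_ne_zero this

theorem integral_exp_neg_mul_abs_sub {t : ℝ} (ht : 0 ≤ t) :
    ∫ s in Set.Ioi (0 : ℝ), Real.exp (-s) * |s - t| = t - 1 + 2 * Real.exp (-t) := by
  have hint : IntegrableOn (fun s : ℝ => Real.exp (-s) * (s - t)) (Set.Ioi 0) := by
    have h := integrableOn_exp_neg_mul_self.sub (integrableOn_exp_neg.mul_const t)
    exact h.congr (ae_of_all _ fun s => by simp; ring)
  have htail : ∫ s in Set.Ioi t, Real.exp (-s) * |s - t| = Real.exp (-t) := by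
    have h0 : ∫ s in Set.Ioi t, Real.exp (-s) * |s - t| =
        ∫ s in Set.Ioi t, Real.exp (-s) * (s - t) :=
      setIntegral_congr_fun measurableSet_Ioi fun s hs => by
        have : t < s := hs
        rw [abs_of_pos (by linarith)]
    rw [h0]
    -- Translation by `t`: the exponential distribution is memoryless.
    have h1 := (measurePreserving_add_right (volume : Measure ℝ) t).setIntegral_preimage_emb
      (measurableEmbedding_addRight t) (fun s => Real.exp (-s) * (s - t)) (Set.Ioi t)
    rw [← h1]
    simp only [Set.preimage_add_const_Ioi, sub_self, add_sub_cancel_right, neg_add, Real.exp_add]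
    have h2 : ∀ x : ℝ, Real.exp (-x) * Real.exp (-t) * x = Real.exp (-t) * (Real.exp (-x) * x) :=
      fun x => by ring
    simp only [h2]
    rw [integral_const_mul, integral_exp_neg_mul_self, mul_one]
  have hmono : Set.Ioi t ⊆ Set.Ioi (0 : ℝ) := Set.Ioi_subset_Ioi ht
  have hsplit : ∀ f : ℝ → ℝ, IntegrableOn f (Set.Ioi 0) → ∫ s in Set.Ioi (0 : ℝ), f s =
      (∫ s in Set.Ioc 0 t, f s) + ∫ s in Set.Ioi t, f s := by
    intro f hf
    rw [← setIntegral_union (Set.Ioc_disjoint_Ioi le_rfl) measurableSet_Ioi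
      (hf.mono_set Set.Ioc_subset_Ioi_self) (hf.mono_set hmono), Set.Ioc_union_Ioi_eq_Ioi ht]
  have habs : IntegrableOn (fun s : ℝ => Real.exp (-s) * |s - t|) (Set.Ioi 0) := by
    refine hint.norm.congr (ae_of_all _ fun s => ?_)
    simp
  have h1 := hsplit _ habs
  have h2 := hsplit _ hint
  have h3 : ∫ s in Set.Ioc 0 t, Real.exp (-s) * |s - t| =
      - ∫ s in Set.Ioc 0 t, Real.exp (-s) * (s - t) := by
    rw [← integral_neg]
    refine setIntegral_congr_fun measurableSet_Ioc fun s hs => ?_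
    rw [abs_of_nonpos (by linarith [hs.2])]
    ring
  have h4 : ∫ s in Set.Ioi t, Real.exp (-s) * (s - t) = Real.exp (-t) := by
    rw [← htail]
    refine setIntegral_congr_fun measurableSet_Ioi fun s hs => ?_
    have : t < s := hs
    rw [abs_of_pos (by linarith)]
  have h5 : ∫ s in Set.Ioi (0 : ℝ), Real.exp (-s) * (s - t) = 1 - t := by
    simp only [mul_sub]
    rw [integral_sub integrableOn_exp_neg_mul_self (integrableOn_exp_neg.mul_const t),
      integral_exp_neg_mul_self, integral_mul_const, integral_exp_neg_Ioi_eq_one, one_mul]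
  rw [h1, h3, htail]
  linarith

/-- The mean absolute difference of two independent exponential variables. -/
theorem integral_abs_norm_sq_sub :
    ∫ p : ℂ × ℂ, |‖p.1‖ ^ 2 - ‖p.2‖ ^ 2| ∂(complexGaussian.prod complexGaussian) = 1 := by
  have hi : Integrable (fun p : ℂ × ℂ => |‖p.1‖ ^ 2 - ‖p.2‖ ^ 2|)
      (complexGaussian.prod complexGaussian) :=
    ((integrable_norm_sq_complexGaussian.comp_fst _).sub
      (integrable_norm_sq_complexGaussian.comp_snd _)).abs
  rw [integral_prod_symm _ hi]
  have h1 : ∀ w : ℂ, ∫ z, |‖z‖ ^ 2 - ‖w‖ ^ 2| ∂complexGaussian =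
      (fun t => t - 1 + 2 * Real.exp (-t)) (‖w‖ ^ 2) := fun w => by
    rw [integral_complexGaussian_norm_sq (fun s => |s - ‖w‖ ^ 2|),
      integral_exp_neg_mul_abs_sub (by positivity)]
  simp only [h1]
  rw [integral_complexGaussian_norm_sq (fun t => t - 1 + 2 * Real.exp (-t))]
  have h2 : ∀ s : ℝ, Real.exp (-s) * (s - 1 + 2 * Real.exp (-s)) =
      Real.exp (-s) * s - Real.exp (-s) + 2 * Real.exp (-2 * s) := fun s => by
    rw [show -2 * s = -s + -s by ring, Real.exp_add]; ring
  simp only [h2]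
  have h3 : IntegrableOn (fun s : ℝ => Real.exp (-2 * s)) (Set.Ioi 0) :=
    integrableOn_exp_mul_Ioi (by norm_num) 0
  have h4 : IntegrableOn (fun s : ℝ => Real.exp (-s) * s - Real.exp (-s)) (Set.Ioi 0) :=
    integrableOn_exp_neg_mul_self.sub integrableOn_exp_neg
  rw [integral_add h4 (h3.const_mul 2),
    integral_sub integrableOn_exp_neg_mul_self integrableOn_exp_neg, integral_const_mul,
    integral_exp_mul_Ioi (by norm_num), integral_exp_neg_mul_self, integral_exp_neg_Ioi_eq_one]
  norm_num

/-! ### Rotation invariance -/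

/-- The standard Gaussian distribution on the space of two-qubit vectors. -/
def gaussianVector : Measure (BitString 2 → ℂ) := Measure.pi fun _ => complexGaussian

instance : IsProbabilityMeasure gaussianVector := by unfold gaussianVector; infer_instance

/-- The square of the Euclidean norm. -/
def normSqSum (v : BitString 2 → ℂ) : ℝ := ∑ b, ‖v b‖ ^ 2

theorem continuous_normSqSum : Continuous normSqSum :=
  continuous_finsetSum _ fun b _ => ((continuous_apply b).norm).pow 2

theorem normSqSum_mulVec (h : TwoQubitGate) (v : BitString 2 → ℂ) :
    normSqSum (h.1.mulVec v) = normSqSum v := by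
  have h1 : ∀ v : BitString 2 → ℂ, ((normSqSum v : ℝ) : ℂ) = star v ⬝ᵥ v := fun v => by
    simp only [normSqSum, dotProduct, Pi.star_apply]
    push_cast
    exact Finset.sum_congr rfl fun b _ => (Complex.conj_mul' _).symm
  have h2 : star (h.1.mulVec v) ⬝ᵥ h.1.mulVec v = star v ⬝ᵥ v := by
    rw [Matrix.star_mulVec, ← Matrix.dotProduct_mulVec, Matrix.mulVec_mulVec,
      ← Matrix.star_eq_conjTranspose, Matrix.mem_unitaryGroup_iff'.1 h.2, Matrix.one_mulVec]
  rw [← h1, ← h1] at h2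
  exact_mod_cast h2

theorem gaussianVector_eq_withDensity : gaussianVector = volume.withDensity fun v =>
    ENNReal.ofReal (Real.exp (-normSqSum v) / Real.pi ^ 4) := by
  refine Measure.pi_eq fun s hs => ?_
  have hf : Integrable fun z : ℂ => Real.exp (-‖z‖ ^ 2) / Real.pi := by
    by_contra h
    have h1 := integral_complexGaussian fun _ => 1
    simp only [mul_one, integral_undef h] at h1
    simp at h1
  have hprod : ∀ v : BitString 2 → ℂ, Real.exp (-normSqSum v) / Real.pi ^ 4 =
      ∏ b, (Real.exp (-‖v b‖ ^ 2) / Real.pi) := fun v => by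
    rw [Finset.prod_div_distrib, ← Real.exp_sum, Finset.prod_const, Finset.sum_neg_distrib]
    simp [normSqSum]
  have hvol : (volume : Measure (BitString 2 → ℂ)).restrict (Set.univ.pi s) =
      Measure.pi fun b => volume.restrict (s b) := by
    rw [volume_pi, Measure.restrict_pi_pi]
  rw [withDensity_apply _ (MeasurableSet.univ_pi hs), hvol]
  simp only [hprod]
  rw [← ofReal_integral_eq_lintegral_ofReal
    (Integrable.fintype_prod (μ := fun b => volume.restrict (s b))
      (f := fun _ z => Real.exp (-‖z‖ ^ 2) / Real.pi) fun b => hf.restrict)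
    (ae_of_all _ fun v => Finset.prod_nonneg fun b _ => by positivity),
    integral_fintype_prod_eq_prod (fun _ z => Real.exp (-‖z‖ ^ 2) / Real.pi),
    ENNReal.ofReal_prod_of_nonneg fun b _ => integral_nonneg fun z => by positivity]
  refine Finset.prod_congr rfl fun b _ => ?_
  rw [complexGaussian, withDensity_apply _ (hs b), ofReal_integral_eq_lintegral_ofReal hf.restrict
    (ae_of_all _ fun z => by positivity)]

/-- Unitary maps preserve volume. -/
theorem measurePreserving_mulVec (h : TwoQubitGate) :
    MeasurePreserving (fun v : BitString 2 → ℂ => h.1.mulVec v) := by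
  set L : (BitString 2 → ℂ) →ₗ[ℝ] (BitString 2 → ℂ) := (Matrix.mulVecLin h.1).restrictScalars ℝ
    with hL
  have hLapp : ∀ v, L v = h.1.mulVec v := fun v => rfl
  set L' : (BitString 2 → ℂ) →ₗ[ℝ] (BitString 2 → ℂ) :=
    (Matrix.mulVecLin (star h.1)).restrictScalars ℝ with hL'
  have hcomp : L' ∘ₗ L = LinearMap.id := by
    refine LinearMap.ext fun v => ?_
    change (star h.1).mulVec (h.1.mulVec v) = v
    rw [Matrix.mulVec_mulVec, Matrix.mem_unitaryGroup_iff'.1 h.2, Matrix.one_mulVec]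
  have hdet : LinearMap.det L ≠ 0 := by
    intro h0
    have := congrArg LinearMap.det hcomp
    rw [LinearMap.det_comp, h0, mul_zero, LinearMap.det_id] at this
    exact zero_ne_one this
  have hcont : Continuous L := L.continuous_of_finiteDimensional
  refine ⟨hcont.measurable, ?_⟩
  have hmap := Measure.map_linearMap_addHaar_eq_smul_addHaar
    (volume : Measure (BitString 2 → ℂ)) hdet
  -- A linear map scales volume by a constant, which is `1` because the Euclidean unit ball is
  -- mapped to itself.
  set S : Set (BitString 2 → ℂ) := {v | normSqSum v < 1} with hS
  have hSo : IsOpen S := isOpen_lt continuous_normSqSum continuous_const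
  have hS0 : volume S ≠ 0 := (hSo.measure_pos _ ⟨0, by simp [hS, normSqSum]⟩).ne'
  have hSt : volume S ≠ ⊤ := by
    refine ((measure_mono ?_).trans_lt
      (Metric.isBounded_ball (x := (0 : BitString 2 → ℂ)) (r := 1)).measure_lt_top).ne
    intro v hv
    rw [mem_ball_zero_iff, pi_norm_lt_iff one_pos]
    intro b
    have h1 : ‖v b‖ ^ 2 ≤ normSqSum v :=
      Finset.single_le_sum (f := fun b => ‖v b‖ ^ 2) (fun _ _ => sq_nonneg _) (Finset.mem_univ b)
    have h2 : ‖v b‖ ^ 2 < 1 := h1.trans_lt hv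
    exact (sq_lt_one_iff₀ (norm_nonneg _)).1 h2
  have h1 := congrArg (fun μ => μ S) hmap
  simp only [Measure.smul_apply, smul_eq_mul] at h1
  rw [Measure.map_apply hcont.measurable hSo.measurableSet] at h1
  have h2 : L ⁻¹' S = S := by
    ext v
    simp only [hS, Set.mem_preimage, Set.mem_ofPred_eq, hLapp, normSqSum_mulVec]
  rw [h2] at h1
  have h3 : ENNReal.ofReal |(LinearMap.det L)⁻¹| = 1 :=
    (ENNReal.mul_eq_right hS0 hSt).1 h1.symm
  rw [h3, one_smul] at hmap
  exact hmap

theorem integral_gaussianVector_mulVec (h : TwoQubitGate) (f : (BitString 2 → ℂ) → ℝ)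
    (hf : Continuous f) :
    ∫ v, f (h.1.mulVec v) ∂gaussianVector = ∫ v, f v ∂gaussianVector := by
  have hD : Continuous fun v => Real.exp (-normSqSum v) / Real.pi ^ 4 :=
    (Real.continuous_exp.comp continuous_normSqSum.neg).div_const _
  have hint : ∀ f : (BitString 2 → ℂ) → ℝ, ∫ v, f v ∂gaussianVector =
      ∫ v, Real.exp (-normSqSum v) / Real.pi ^ 4 * f v := fun f => by
    rw [gaussianVector_eq_withDensity, integral_withDensity_eq_integral_toReal_smul]
    · refine integral_congr_ae (ae_of_all _ fun z => ?_)
      simp only [smul_eq_mul]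
      rw [ENNReal.toReal_ofReal (by positivity)]
    · exact ENNReal.measurable_ofReal.comp hD.measurable
    · exact ae_of_all _ fun _ => ENNReal.ofReal_lt_top
  rw [hint, hint]
  have hp := measurePreserving_mulVec h
  conv_rhs => rw [← hp.map_eq, integral_map hp.measurable.aemeasurable
    (hp.map_eq ▸ (hD.mul hf).aestronglyMeasurable)]
  simp only [normSqSum_mulVec]

theorem integral_gaussianVector_apply (b : BitString 2) :
    ∫ v, ‖v b‖ ^ 2 ∂gaussianVector = 1 := by
  have h := measurePreserving_eval (fun _ : BitString 2 => complexGaussian) b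
  rw [← integral_norm_sq_complexGaussian, ← h.map_eq, integral_map h.measurable.aemeasurable]
  · rfl
  · exact (continuous_norm.pow 2).aestronglyMeasurable

theorem integrable_gaussianVector_apply (b : BitString 2) :
    Integrable (fun v => ‖v b‖ ^ 2) gaussianVector := by
  by_contra h
  have := integral_undef h
  rw [integral_gaussianVector_apply] at this
  exact one_ne_zero this

theorem integral_normSqSum : ∫ v, normSqSum v ∂gaussianVector = 4 := by
  simp only [normSqSum]
  rw [integral_finsetSum _ fun b _ => integrable_gaussianVector_apply b]
  simp [integral_gaussianVector_apply]

theorem integrable_normSqSum : Integrable normSqSum gaussianVector :=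
  integrable_finsetSum _ fun b _ => integrable_gaussianVector_apply b

theorem integral_gaussianVector_abs_sub {a a' : BitString 2} (ha : a ≠ a') :
    ∫ v, |‖v a‖ ^ 2 - ‖v a'‖ ^ 2| ∂gaussianVector = 1 := by
  have hind := (ProbabilityTheory.iIndepFun_pi (μ := fun _ : BitString 2 => complexGaussian)
    (X := fun _ z => z) fun _ => aemeasurable_id).indepFun ha
  rw [ProbabilityTheory.indepFun_iff_map_prod_eq_prod_map_map
    (measurable_pi_apply a).aemeasurable (measurable_pi_apply a').aemeasurable] at hind
  have h1 := (measurePreserving_eval (fun _ : BitString 2 => complexGaussian) a).map_eq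
  have h2 := (measurePreserving_eval (fun _ : BitString 2 => complexGaussian) a').map_eq
  have h3 : Measure.map (fun v : BitString 2 → ℂ => (v a, v a')) gaussianVector =
      complexGaussian.prod complexGaussian := by
    refine hind.trans ?_
    congr 1
  rw [← integral_abs_norm_sq_sub, ← h3, integral_map (by fun_prop)]
  exact Continuous.aestronglyMeasurable (by fun_prop)

/-- The unitary group acts transitively on the unit sphere. -/
theorem exists_gate_mulVec_single {u : BitString 2 → ℂ} (hu : normSqSum u = 1) :
    ∃ h : TwoQubitGate, h.1.mulVec (Pi.single 0 1) = u := by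
  have hv : Orthonormal ℂ (({0} : Set (BitString 2)).domRestrict
      fun _ : BitString 2 => WithLp.toLp 2 u) := by
    refine ⟨fun i => ?_, fun i j hij => (hij (Subsingleton.elim _ _)).elim⟩
    rw [Set.domRestrict_apply, EuclideanSpace.norm_eq]
    simpa [normSqSum] using hu
  obtain ⟨b, hb⟩ := hv.exists_orthonormalBasis_extension_of_card_eq (by simp)
  refine ⟨⟨Matrix.of fun x y => b y x, ?_⟩, ?_⟩
  · rw [Matrix.mem_unitaryGroup_iff']
    ext x y
    rw [Matrix.one_apply, ← orthonormal_iff_ite.1 b.orthonormal x y, PiLp.inner_apply]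
    simp [Matrix.mul_apply, Matrix.star_apply, mul_comm]
  · rw [Matrix.mulVec_single_one]
    ext x
    simp [hb 0 rfl]

theorem continuous_gate_mulVec (b : BitString 2) :
    Continuous fun p : TwoQubitGate × (BitString 2 → ℂ) => p.1.1.mulVec p.2 b := by
  simp only [Matrix.mulVec, dotProduct]
  exact continuous_finsetSum _ fun c _ => ((continuous_gate_apply b c).comp continuous_fst).mul
    ((continuous_apply c).comp continuous_snd)

theorem continuous_abs_sub (a a' : BitString 2) :
    Continuous fun v : BitString 2 → ℂ => |‖v a‖ ^ 2 - ‖v a'‖ ^ 2| := by fun_prop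

/-- The mean absolute difference of two outcome probabilities of a Haar random gate. -/
theorem integral_gate_abs_sub {a a' : BitString 2} (ha : a ≠ a') (v : BitString 2 → ℂ) :
    ∫ g : TwoQubitGate, |‖g.1.mulVec v a‖ ^ 2 - ‖g.1.mulVec v a'‖ ^ 2| ∂haarU4 =
      normSqSum v / 4 := by
  set F : (BitString 2 → ℂ) → ℝ := fun v =>
    ∫ g : TwoQubitGate, |‖g.1.mulVec v a‖ ^ 2 - ‖g.1.mulVec v a'‖ ^ 2| ∂haarU4 with hF
  -- `U(4)` is transitive on the unit sphere and the Haar measure is right invariant, so `F` depends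
  -- on the norm alone, and quadratically.
  have hhom : ∀ v, F v = normSqSum v * F (Pi.single 0 1) := by
    intro v
    by_cases hv : normSqSum v = 0
    · have hv0 : v = 0 := by
        funext b
        have := (Finset.sum_eq_zero_iff_of_nonneg (fun b _ => sq_nonneg ‖v b‖)).1 hv b
          (Finset.mem_univ b)
        simpa using this
      simp [hF, hv0, normSqSum]
    · have hpos : 0 < normSqSum v := lt_of_le_of_ne
        (Finset.sum_nonneg fun b _ => sq_nonneg _) (Ne.symm hv)
      set r : ℝ := Real.sqrt (normSqSum v) with hr
      have hr0 : 0 < r := Real.sqrt_pos.2 hpos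
      have hr2 : r ^ 2 = normSqSum v := Real.sq_sqrt hpos.le
      have hsmul : ∀ (c : ℝ) (w : BitString 2 → ℂ) (b : BitString 2),
          ‖((c : ℂ) • w) b‖ ^ 2 = c ^ 2 * ‖w b‖ ^ 2 := fun c w b => by
        rw [Pi.smul_apply, smul_eq_mul, norm_mul, mul_pow, Complex.norm_real, Real.norm_eq_abs,
          sq_abs]
      obtain ⟨h, hh⟩ := exists_gate_mulVec_single (u := ((r⁻¹ : ℝ) : ℂ) • v) (by
        simp only [normSqSum, hsmul]
        rw [← Finset.mul_sum, inv_pow, hr2]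
        exact inv_mul_cancel₀ hv)
      have hvr : v = (r : ℂ) • h.1.mulVec (Pi.single 0 1) := by
        rw [hh, smul_smul, ← Complex.ofReal_mul, mul_inv_cancel₀ hr0.ne', Complex.ofReal_one,
          one_smul]
      have h1 : ∀ g : TwoQubitGate, |‖g.1.mulVec v a‖ ^ 2 - ‖g.1.mulVec v a'‖ ^ 2| =
          normSqSum v * |‖(g * h).1.mulVec (Pi.single 0 1) a‖ ^ 2 -
            ‖(g * h).1.mulVec (Pi.single 0 1) a'‖ ^ 2| := by
        intro g
        have h2 : g.1.mulVec v = (r : ℂ) • (g * h).1.mulVec (Pi.single 0 1) := by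
          conv_lhs => rw [hvr]
          rw [Matrix.mulVec_smul, Matrix.mulVec_mulVec]
          rfl
        rw [h2, hsmul, hsmul, hr2, ← mul_sub, abs_mul, abs_of_pos hpos]
      simp only [hF, h1]
      rw [integral_const_mul, integral_mul_right_eq_self (fun g : TwoQubitGate =>
        |‖g.1.mulVec (Pi.single 0 1) a‖ ^ 2 - ‖g.1.mulVec (Pi.single 0 1) a'‖ ^ 2|) h]
  -- Averaging `F` over a Gaussian vector instead: by Fubini and rotation invariance the gate
  -- disappears, and two independent exponential variables remain. Since the mean of `normSqSum` is
  -- `4`, this fixes `F`.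
  have hswap : ∫ v, F v ∂gaussianVector = 1 := by
    rw [hF, integral_integral_swap]
    · have : ∀ g : TwoQubitGate, ∫ v, |‖g.1.mulVec v a‖ ^ 2 - ‖g.1.mulVec v a'‖ ^ 2|
          ∂gaussianVector = 1 := fun g => by
        rw [integral_gaussianVector_mulVec g _ (continuous_abs_sub a a'),
          integral_gaussianVector_abs_sub ha]
      simp [this]
    · refine (integrable_normSqSum.comp_fst haarU4).mono' ?_ (ae_of_all _ fun p => ?_)
      · refine Continuous.aestronglyMeasurable ?_
        exact ((((continuous_gate_mulVec a).comp continuous_swap).norm.pow 2).sub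
          (((continuous_gate_mulVec a').comp continuous_swap).norm.pow 2)).abs
      · have h1 : ∀ w : BitString 2 → ℂ, |‖w a‖ ^ 2 - ‖w a'‖ ^ 2| ≤ normSqSum w := fun w => by
          have h2 : ∀ b, ‖w b‖ ^ 2 ≤ normSqSum w := fun b =>
            Finset.single_le_sum (f := fun b => ‖w b‖ ^ 2) (fun _ _ => sq_nonneg _)
              (Finset.mem_univ b)
          rw [abs_le]
          constructor <;> nlinarith [h2 a, h2 a', sq_nonneg ‖w a‖, sq_nonneg ‖w a'‖]
        simp only [Function.uncurry]
        rw [Real.norm_eq_abs, abs_abs, ← normSqSum_mulVec p.2]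
        exact h1 _
  have h4 : ∫ v, F v ∂gaussianVector = 4 * F (Pi.single 0 1) := by
    rw [integral_congr_ae (ae_of_all _ hhom), integral_mul_const, integral_normSqSum]
  have h5 := hhom v
  change F v = _
  rw [h5]
  linarith [show normSqSum v * (4 * F (Pi.single 0 1)) = normSqSum v * 1 by rw [← h4, hswap]]

/-! ### Output distributions are far from any fixed distribution -/

theorem permGate_mulVec (π : Equiv.Perm (BitString 2)) (v : BitString 2 → ℂ) (a : BitString 2) :
    (permGate π).1.mulVec v a = v (π a) := by
  simp [permGate, Matrix.mulVec, dotProduct]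

theorem continuous_gate_mulVec_left (v : BitString 2 → ℂ) (b : BitString 2) :
    Continuous fun g : TwoQubitGate => g.1.mulVec v b :=
  (continuous_gate_mulVec b).comp (Continuous.prodMk_left v)

theorem integrable_real_of_continuous {f : TwoQubitGate → ℝ} (hf : Continuous f) :
    Integrable f haarU4 :=
  hf.integrable_of_hasCompactSupport (HasCompactSupport.of_compactSpace f)

/-- All outcomes have the same law, by invariance under permutations of the basis. The triangle
inequality through `D` therefore bounds the mean difference of two outcomes, `normSqSum v / 4`, by
twice the integral. -/
theorem normSqSum_le_integral_abs_sub (v : BitString 2 → ℂ) (a : BitString 2) (D : ℝ) :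
    normSqSum v / 8 ≤ ∫ g : TwoQubitGate, |‖g.1.mulVec v a‖ ^ 2 - D| ∂haarU4 := by
  obtain ⟨a', ha⟩ := exists_ne a
  have hc : ∀ b, Continuous fun g : TwoQubitGate => ‖g.1.mulVec v b‖ ^ 2 := fun b =>
    (continuous_gate_mulVec_left v b).norm.pow 2
  have h1 : ∫ g : TwoQubitGate, |‖g.1.mulVec v a'‖ ^ 2 - D| ∂haarU4 =
      ∫ g : TwoQubitGate, |‖g.1.mulVec v a‖ ^ 2 - D| ∂haarU4 := by
    rw [← integral_mul_left_eq_self _ (permGate (Equiv.swap a a'))]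
    refine integral_congr_ae (ae_of_all _ fun g => ?_)
    have : ((permGate (Equiv.swap a a')) * g).1.mulVec v a' = g.1.mulVec v a := by
      change ((permGate (Equiv.swap a a')).1 * g.1).mulVec v a' = _
      rw [← Matrix.mulVec_mulVec, permGate_mulVec, Equiv.swap_apply_right]
    simp only [this]
  have hi : ∀ b, Integrable (fun g : TwoQubitGate => |‖g.1.mulVec v b‖ ^ 2 - D|) haarU4 :=
    fun b => integrable_real_of_continuous ((hc b).sub continuous_const).abs
  have h2 : ∫ g : TwoQubitGate, |‖g.1.mulVec v a‖ ^ 2 - ‖g.1.mulVec v a'‖ ^ 2| ∂haarU4 ≤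
      ∫ g : TwoQubitGate, (|‖g.1.mulVec v a‖ ^ 2 - D| + |‖g.1.mulVec v a'‖ ^ 2 - D|) ∂haarU4 := by
    refine integral_mono (integrable_real_of_continuous ((hc a).sub (hc a')).abs)
      ((hi a).add (hi a')) fun g => ?_
    rw [abs_sub_comm (‖g.1.mulVec v a'‖ ^ 2) D]
    exact abs_sub_le _ _ _
  rw [integral_add (hi a) (hi a'), h1, integral_gate_abs_sub ha.symm] at h2
  linarith

/-! ### Isolating the gate on the first pair of a layer. -/

theorem layerMatrix_mul (m k : ℕ) (G H : Fin m → TwoQubitGate) :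
    layerMatrix m k (G * H) = layerMatrix m k G * layerMatrix m k H := by
  ext x y
  rw [Matrix.mul_apply]
  simp only [layerMatrix, ← Finset.prod_mul_distrib]
  have h := (splitBits m k).sum_comp (fun w => ∏ j, (G j).1 (splitBits m k x j) (w j) *
    (H j).1 (w j) (splitBits m k y j))
  refine Eq.trans ?_ h.symm
  rw [sum_prod_eq_prod_sum (fun j (w : BitString 2) => (G j).1 (splitBits m k x j) w *
    (H j).1 w (splitBits m k y j))]
  rfl

theorem layer_mul (m k : ℕ) (G H : Fin m → TwoQubitGate) :
    layer m k (G * H) = layer m k G * layer m k H :=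
  Subtype.ext (layerMatrix_mul m k G H)

/-- Bit strings as a first pair of bits and the remaining pairs, in layer `k`. -/
def firstPairEquiv (m k : ℕ) : BitString 2 × (Fin m → BitString 2) ≃ BitString ((m + 1) * 2) :=
  (Fin.consEquiv fun _ => BitString 2).trans (splitBits (m + 1) k).symm

theorem layerMatrix_mulSingle_mulVec (m k : ℕ) (h : TwoQubitGate)
    (ψ : BitString ((m + 1) * 2) → ℂ) (a : BitString 2) (r : Fin m → BitString 2) :
    (layerMatrix (m + 1) k (Pi.mulSingle 0 h)).mulVec ψ (firstPairEquiv m k (a, r)) =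
      h.1.mulVec (fun u => ψ (firstPairEquiv m k (u, r))) a := by
  have hs : ∀ (p : BitString 2 × (Fin m → BitString 2)) (j : Fin (m + 1)),
      (fun b => firstPairEquiv m k p (pairing (m + 1) k (j, b))) =
        (Fin.cons p.1 p.2 : Fin (m + 1) → BitString 2) j := fun p j => by
    have : splitBits (m + 1) k (firstPairEquiv m k p) =
        (Fin.cons p.1 p.2 : Fin (m + 1) → BitString 2) := by
      simp [firstPairEquiv, Fin.consEquiv]
    rw [← this]
    rfl
  simp only [Matrix.mulVec, dotProduct]
  rw [← (firstPairEquiv m k).sum_comp, Fintype.sum_prod_type]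
  refine Finset.sum_congr rfl fun u _ => ?_
  rw [Finset.sum_eq_single r]
  · simp only [layerMatrix, hs, Fin.prod_univ_succ, Fin.cons_zero, Fin.cons_succ]
    simp [Fin.succ_ne_zero, Pi.mulSingle_eq_of_ne]
  · intro r' _ hr'
    obtain ⟨j, hj⟩ := Function.ne_iff.1 hr'
    simp only [layerMatrix, hs, Fin.prod_univ_succ, Fin.cons_zero, Fin.cons_succ]
    rw [Finset.prod_eq_zero (Finset.mem_univ j), mul_zero, zero_mul]
    rw [Pi.mulSingle_eq_of_ne (Fin.succ_ne_zero j)]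
    exact Matrix.one_apply_ne hj.symm
  · simp

theorem continuous_layer_apply (m k : ℕ) (W : Matrix.unitaryGroup (BitString (m * 2)) ℂ)
    (x : BitString (m * 2)) :
    Continuous fun G : Fin m → TwoQubitGate => (born (layer m k G * W)).1 x := by
  refine Continuous.pow (Continuous.norm ?_) 2
  change Continuous fun G : Fin m → TwoQubitGate => (layerMatrix m k G * W.1) x 0
  simp only [Matrix.mul_apply]
  exact continuous_finsetSum _ fun w _ => (continuous_layerMatrix_apply m k x w).mul continuous_const

theorem continuous_dTV_left {α X : Type*} [TopologicalSpace α] [Fintype X] {P : α → ProbDist X}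
    (hP : ∀ x, Continuous fun a => (P a).1 x) (D : ProbDist X) :
    Continuous fun a => dTV (P a) D :=
  continuous_const.mul (continuous_finsetSum _ fun x _ => ((hP x).sub continuous_const).abs)

/-- For each value `r` of the other bits, the four outcomes of the first pair contribute at least an
eighth of the squared norm each. The total is `1/2 * 4 * 1/8`. -/
theorem le_integral_dTV_mulSingle (m k : ℕ)
    (W : Matrix.unitaryGroup (BitString ((m + 1) * 2)) ℂ)
    (D : ProbDist (BitString ((m + 1) * 2))) :
    1 / 4 ≤ ∫ h : TwoQubitGate, dTV (born (layer (m + 1) k (Pi.mulSingle 0 h) * W)) D ∂haarU4 := by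
  set ψ : BitString ((m + 1) * 2) → ℂ := fun x => W.1 x 0 with hψ
  have hψ1 : ∑ x, ‖ψ x‖ ^ 2 = 1 := (born W).2.2
  have hb : ∀ (h : TwoQubitGate) x, (born (layer (m + 1) k (Pi.mulSingle 0 h) * W)).1 x =
      ‖(layerMatrix (m + 1) k (Pi.mulSingle 0 h)).mulVec ψ x‖ ^ 2 := fun h x => rfl
  have hsum : ∀ h : TwoQubitGate, dTV (born (layer (m + 1) k (Pi.mulSingle 0 h) * W)) D =
      (1 / 2) * ∑ a, ∑ r, |‖h.1.mulVec (fun u => ψ (firstPairEquiv m k (u, r))) a‖ ^ 2 -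
        D.1 (firstPairEquiv m k (a, r))| := fun h => by
    rw [dTV, ← (firstPairEquiv m k).sum_comp, Fintype.sum_prod_type]
    simp only [hb, layerMatrix_mulSingle_mulVec]
  have hi : ∀ a r, Integrable (fun h : TwoQubitGate =>
      |‖h.1.mulVec (fun u => ψ (firstPairEquiv m k (u, r))) a‖ ^ 2 -
        D.1 (firstPairEquiv m k (a, r))|) haarU4 := fun a r =>
    integrable_real_of_continuous
      (((continuous_gate_mulVec_left _ a).norm.pow 2).sub continuous_const).abs
  simp only [hsum]
  rw [integral_const_mul, integral_finsetSum _ fun a _ => integrable_finsetSum _ fun r _ => hi a r]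
  simp only [integral_finsetSum _ fun r _ => hi _ r]
  have h1 : ∑ _a : BitString 2, ∑ r : Fin m → BitString 2,
      normSqSum (fun u => ψ (firstPairEquiv m k (u, r))) / 8 = 1 / 2 := by
    have h2 : ∑ r : Fin m → BitString 2, normSqSum (fun u => ψ (firstPairEquiv m k (u, r))) = 1 := by
      simp only [normSqSum]
      rw [Finset.sum_comm, ← hψ1, ← (firstPairEquiv m k).sum_comp, Fintype.sum_prod_type]
    rw [← Finset.sum_div, h2]
    simp
    norm_num
  have h3 := Finset.sum_le_sum fun (a : BitString 2) (_ : a ∈ Finset.univ) =>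
    Finset.sum_le_sum fun (r : Fin m → BitString 2) (_ : r ∈ Finset.univ) =>
      normSqSum_le_integral_abs_sub (fun u => ψ (firstPairEquiv m k (u, r))) a
        (D.1 (firstPairEquiv m k (a, r)))
  rw [h1] at h3
  linarith

/-- An extra Haar gate on the first pair can be multiplied onto the layer without changing its law;
the bound for that gate then holds with everything else fixed. -/
theorem le_integral_dTV_layer (m k : ℕ)
    (W : Matrix.unitaryGroup (BitString ((m + 1) * 2)) ℂ)
    (D : ProbDist (BitString ((m + 1) * 2))) :
    1 / 4 ≤ ∫ G, dTV (born (layer (m + 1) k G * W)) D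
      ∂(Measure.pi fun _ : Fin (m + 1) => haarU4) := by
  let e : TwoQubitGate → Fin (m + 1) → TwoQubitGate := fun h => Pi.mulSingle 0 h
  have he : Continuous e :=
    continuous_mulSingle (A := fun _ : Fin (m + 1) => TwoQubitGate) 0
  set ν : Measure (Fin (m + 1) → TwoQubitGate) := Measure.pi fun _ => haarU4
  have hc : Continuous fun G => dTV (born (layer (m + 1) k G * W)) D :=
    continuous_dTV_left (continuous_layer_apply (m + 1) k W) D
  have h1 : ∫ G, dTV (born (layer (m + 1) k G * W)) D ∂ν = ∫ h : TwoQubitGate, ∫ G,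
      dTV (born (layer (m + 1) k (e h * G) * W)) D ∂ν ∂haarU4 := by
    have : ∀ h : TwoQubitGate, ∫ G,
        dTV (born (layer (m + 1) k (e h * G) * W)) D ∂ν =
          ∫ G, dTV (born (layer (m + 1) k G * W)) D ∂ν := fun h =>
      integral_mul_left_eq_self (fun G => dTV (born (layer (m + 1) k G * W)) D) (e h)
    simp [this]
  rw [h1, integral_integral_swap]
  · have h2 : ∀ G, 1 / 4 ≤ ∫ h : TwoQubitGate,
        dTV (born (layer (m + 1) k (e h * G) * W)) D ∂haarU4 := fun G => by
      simp only [layer_mul, mul_assoc]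
      exact le_integral_dTV_mulSingle m k (layer (m + 1) k G * W) D
    have hc2 : Continuous fun p : (Fin (m + 1) → TwoQubitGate) × TwoQubitGate =>
        dTV (born (layer (m + 1) k (e p.2 * p.1) * W)) D :=
      hc.comp ((he.comp continuous_snd).mul continuous_fst)
    calc (1 / 4 : ℝ) = ∫ _G, (1 / 4 : ℝ) ∂ν := by simp
      _ ≤ _ := integral_mono (integrable_const _)
          (Integrable.integral_prod_left (f := fun p => dTV (born (layer (m + 1) k
            (e p.2 * p.1) * W)) D) (hc2.integrable_of_hasCompactSupport
            (HasCompactSupport.of_compactSpace _))) h2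
  · refine Continuous.integrable_of_hasCompactSupport ?_ (HasCompactSupport.of_compactSpace _)
    exact hc.comp ((he.comp continuous_fst).mul continuous_snd)

theorem continuous_dTV_born (m d : ℕ) (D : ProbDist (BitString (m * 2))) :
    Continuous fun g : CircuitGates m d => dTV (born (brickwork m d g)) D :=
  continuous_dTV_left (continuous_born m d) D

/-- On average, the output distribution is at distance at least `1 / 4` from any distribution. -/
theorem le_integral_dTV_born (m d : ℕ) (D : ProbDist (BitString ((m + 1) * 2))) :
    1 / 4 ≤ ∫ g, dTV (born (brickwork (m + 1) (d + 1) g)) D ∂randomGates (m + 1) (d + 1) := by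
  have h1 := integral_randomGates_succ (m + 1) d (fun p : (Fin (m + 1) → TwoQubitGate) ×
    CircuitGates (m + 1) d => dTV (born (layer (m + 1) d p.1 * brickwork (m + 1) d p.2)) D)
  have hc : Continuous fun p : (Fin (m + 1) → TwoQubitGate) × CircuitGates (m + 1) d =>
      dTV (born (layer (m + 1) d p.1 * brickwork (m + 1) d p.2)) D := by
    refine continuous_dTV_left (fun x => ?_) D
    refine Continuous.pow (Continuous.norm ?_) 2
    change Continuous fun p : (Fin (m + 1) → TwoQubitGate) × CircuitGates (m + 1) d =>
      (layerMatrix (m + 1) d p.1 * (brickwork (m + 1) d p.2).1) x 0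
    simp only [Matrix.mul_apply]
    exact continuous_finsetSum _ fun w _ =>
      ((continuous_layerMatrix_apply (m + 1) d x w).comp continuous_fst).mul
        ((continuous_amplitude (m + 1) d w).comp continuous_snd)
  have hi := hc.integrable_of_hasCompactSupport (HasCompactSupport.of_compactSpace _)
    (μ := (Measure.pi fun _ : Fin (m + 1) => haarU4).prod (randomGates (m + 1) d))
  refine le_of_le_of_eq ?_ h1.symm
  rw [integral_prod_symm _ hi]
  calc (1 / 4 : ℝ) = ∫ _g, (1 / 4 : ℝ) ∂randomGates (m + 1) d := by simp
    _ ≤ _ := integral_mono (integrable_const _) hi.integral_prod_right fun g =>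
        le_integral_dTV_layer m d (brickwork (m + 1) d g) D

/-! ### The statistical query lower bound -/

theorem dTV_le_one {X : Type*} [Fintype X] (P Q : ProbDist X) : dTV P Q ≤ 1 := by
  have h : ∑ x, |P.1 x - Q.1 x| ≤ ∑ x, (P.1 x + Q.1 x) := Finset.sum_le_sum fun x _ => by
    have h1 := P.2.1 x
    have h2 := Q.2.1 x
    rw [abs_le]
    constructor <;> linarith
  rw [Finset.sum_add_distrib, P.2.2, Q.2.2] at h
  rw [dTV]
  linarith

/-- The oracle of `P` that answers with `u` whenever this is a valid answer. -/
def biasedOracle {X : Type*} [Fintype X] (τ : ℝ) (u : QueryFn X → ℝ) (P : ProbDist X)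
    (φ : QueryFn X) : ℝ :=
  if |expect P φ - u φ| ≤ τ then u φ else expect P φ

theorem isStatOracle_biasedOracle {X : Type*} [Fintype X] {τ : ℝ} (hτ : 0 ≤ τ)
    (u : QueryFn X → ℝ) (P : ProbDist X) : IsStatOracle τ P (biasedOracle τ u P) := by
  intro φ
  unfold biasedOracle
  split_ifs with h
  · rwa [abs_sub_comm]
  · simpa using hτ

/-- While the biased oracle answers `u`, the run does not depend on `g`: it meets at most `q`
predetermined queries and one predetermined output. A union bound adds the failure of each. Only
monotonicity and subadditivity enter, so the success event need not be measurable. -/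
theorem measureReal_run_le {Ω X R : Type*} [MeasurableSpace Ω] [Fintype X] (μ : Measure Ω)
    [IsProbabilityMeasure μ] (P : Ω → ProbDist X) (u : QueryFn X → ℝ) (rep : R → ProbDist X)
    {τ ε s p : ℝ} (hs : 0 ≤ s) (hp : 0 ≤ p)
    (hfar : ∀ φ, μ.real {g | τ < |expect (P g) φ - u φ|} ≤ s)
    (hclose : ∀ D, μ.real {g | dTV (P g) D < ε} ≤ p) (q : ℕ) (A : SQAlgorithm X R) :
    μ.real {g | ∃ r, A.run (biasedOracle τ u (P g)) q = some r ∧ dTV (P g) (rep r) < ε} ≤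
      q * s + p := by
  induction q generalizing A with
  | zero =>
    cases A with
    | output r => simpa [SQAlgorithm.run] using hclose (rep r)
    | query φ next => simpa [SQAlgorithm.run] using hp
  | succ q ih =>
    have hqs : 0 ≤ ((q + 1 : ℕ) : ℝ) * s := by positivity
    cases A with
    | output r =>
      have := hclose (rep r)
      simp only [SQAlgorithm.run, Option.some.injEq, exists_eq_left']
      linarith
    | query φ next =>
      have hsub : {g | ∃ r, (SQAlgorithm.query φ next).run (biasedOracle τ u (P g)) (q + 1) =
          some r ∧ dTV (P g) (rep r) < ε} ⊆ {g | τ < |expect (P g) φ - u φ|} ∪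
          {g | ∃ r, (next (u φ)).run (biasedOracle τ u (P g)) q = some r ∧
            dTV (P g) (rep r) < ε} := by
        rintro g ⟨r, hr, hd⟩
        by_cases h : |expect (P g) φ - u φ| ≤ τ
        · right
          rw [SQAlgorithm.run, biasedOracle, if_pos h] at hr
          exact ⟨r, hr, hd⟩
        · exact Or.inl (not_le.1 h)
      have h1 := (measureReal_mono (μ := μ) hsub).trans (measureReal_union_le _ _)
      have h2 := hfar φ
      have h3 := ih (next (u φ))
      push_cast
      linarith

/-- Chebyshev bounds the chance that a query deviates; the bounded distance with mean at least `1/4`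
bounds the chance of being close to a given output. -/
theorem measureReal_learns_le {Ω X R : Type*} [MeasurableSpace Ω] [Fintype X] (μ : Measure Ω)
    [IsProbabilityMeasure μ] (P : Ω → ProbDist X) (u : QueryFn X → ℝ) (rep : R → ProbDist X)
    {τ ε V : ℝ} (hτ : 0 < τ) (hε : 0 ≤ ε)
    (hint : ∀ φ, Integrable (fun g => (expect (P g) φ - u φ) ^ 2) μ)
    (hV : ∀ φ, ∫ g, (expect (P g) φ - u φ) ^ 2 ∂μ ≤ V)
    (hmeas : ∀ D, Measurable fun g => dTV (P g) D)
    (hd : ∀ D, 1 / 4 ≤ ∫ g, dTV (P g) D ∂μ) (q : ℕ) (A : SQAlgorithm X R) :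
    μ.real {g | A.Learns rep τ ε q (P g)} ≤ q * (V / τ ^ 2) + (3 / 4 + ε) := by
  have hV0 : 0 ≤ V := (integral_nonneg fun g => sq_nonneg _).trans (hV fun _ => ⟨0, by norm_num⟩)
  refine (measureReal_mono ?_).trans (measureReal_run_le (τ := τ) (ε := ε) μ P u rep (by positivity)
    (by positivity) ?_ ?_ q A)
  · exact fun g hg => hg _ (isStatOracle_biasedOracle hτ.le u (P g))
  · intro φ
    rw [le_div_iff₀ (by positivity), mul_comm]
    refine le_trans ?_ ((mul_meas_ge_le_integral_of_nonneg (ae_of_all _ fun g => sq_nonneg _)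
      (hint φ) (τ ^ 2)).trans (hV φ))
    refine mul_le_mul_of_nonneg_left (measureReal_mono fun g hg => ?_) (by positivity)
    have hg' : τ < |expect (P g) φ - u φ| := hg
    change τ ^ 2 ≤ (expect (P g) φ - u φ) ^ 2
    rw [← sq_abs (expect (P g) φ - u φ)]
    exact pow_le_pow_left₀ hτ.le hg'.le 2
  · intro D
    have hS : MeasurableSet {g | dTV (P g) D < ε} := measurableSet_lt (hmeas D) measurable_const
    have h0 : ∀ g, 0 ≤ dTV (P g) D := fun g =>
      mul_nonneg (by norm_num) (Finset.sum_nonneg fun _ _ => abs_nonneg _)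
    -- Pointwise, the distance is below `ε` on the event and at most `1` off it.
    have h1 : ∫ g, dTV (P g) D ∂μ ≤
        ∫ g, (1 + ε - ({g | dTV (P g) D < ε} : Set Ω).indicator (fun _ => (1 : ℝ)) g) ∂μ := by
      refine integral_mono ?_ ((integrable_const _).sub ((integrable_const _).indicator hS)) ?_
      · refine (integrable_const (1 : ℝ)).mono' (hmeas D).aestronglyMeasurable
          (ae_of_all _ fun g => ?_)
        rw [Real.norm_eq_abs, abs_of_nonneg (h0 g)]
        exact dTV_le_one _ _
      · intro g
        by_cases hg : dTV (P g) D < ε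
        · simp only [Set.indicator, Set.mem_ofPred_eq, hg, if_true]
          linarith
        · simp only [Set.indicator, Set.mem_ofPred_eq, hg, if_false]
          linarith [dTV_le_one (P g) D]
    rw [integral_sub (integrable_const _) ((integrable_const _).indicator hS),
      integral_indicator_const _ hS] at h1
    simp only [integral_const, probReal_univ, smul_eq_mul, one_mul, mul_one] at h1
    linarith [hd D]

theorem one_add_pow_sub_one_le {y : ℝ} (hy : 0 ≤ y) (m : ℕ) (h : (m + 1) * y ≤ 1) :
    (1 + y) ^ m - 1 ≤ 2 * ((m + 1) * y) := by
  have h0 : 0 ≤ m * y := by positivity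
  have h1 : (1 + y) ^ m ≤ Real.exp (m * y) := by
    rw [Real.exp_nat_mul]
    exact pow_le_pow_left₀ (by positivity) (by linarith [Real.add_one_le_exp y]) m
  have h2 := Real.abs_exp_sub_one_le (x := m * y) (by rw [abs_of_nonneg h0]; linarith)
  rw [abs_of_nonneg h0] at h2
  have h3 := (abs_le.1 h2).2
  linarith

/-- The lower bound on the number of queries in terms of `(5 / 4) ^ d`. -/
theorem LearnsBrickworkFraction.le_mul {m d q : ℕ} {τ ε β : ℝ} {R : Type*}
    {rep : R → ProbDist (BitString (m * 2))} {A : SQAlgorithm (BitString (m * 2)) R}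
    (hτ : 0 < τ) (hε : 0 ≤ ε) (hm : 0 < m) (hK : (m : ℝ) * 2 ≤ (5 / 4) ^ d)
    (hA : LearnsBrickworkFraction m d τ ε β q rep A) :
    (β - 3 / 4 - ε) * τ ^ 2 ≤ q * ((1 / 2) ^ (m * 2) + (m * 2) / (5 / 4) ^ d) := by
  obtain ⟨m, rfl⟩ := Nat.exists_eq_succ_of_ne_zero hm.ne'
  -- At depth `0` the hypothesis would read `m * 2 ≤ 1`.
  have hd : d ≠ 0 := by
    rintro rfl
    push_cast at hK
    have : (0 : ℝ) ≤ m := m.cast_nonneg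
    linarith
  obtain ⟨k, rfl⟩ := Nat.exists_eq_succ_of_ne_zero hd
  simp only [Nat.succ_eq_add_one] at *
  have h1 := measureReal_learns_le (randomGates (m + 1) (k + 1))
    (fun g => born (brickwork (m + 1) (k + 1) g)) uniformExpect rep hτ hε
    (fun φ => integrable_of_continuous_circuit
      (((continuous_expect (m + 1) (k + 1) φ).sub continuous_const).pow 2))
    (integral_expect_sub_sq_le m k) (fun D => (continuous_dTV_born (m + 1) (k + 1) D).measurable)
    (le_integral_dTV_born m k) q A
  have h2 : β ≤ _ := hA.trans h1
  set y : ℝ := (4 / 5) ^ k with hy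
  have hy0 : 0 < y := by positivity
  have hKy : ((5 : ℝ) / 4) ^ (k + 1) = 5 / 4 / y := by
    rw [hy, pow_succ, eq_div_iff (by positivity), mul_right_comm, ← mul_pow]
    norm_num
  rw [hKy] at hK ⊢
  push_cast at hK ⊢
  have h3 : ((m : ℝ) + 1) * y ≤ 5 / 8 := by
    rw [le_div_iff₀ hy0] at hK
    linarith
  have h4 := one_add_pow_sub_one_le hy0.le m (h3.trans (by norm_num))
  have h5 : ((1 : ℝ) / 4) ^ (m + 1) = (1 / 2) ^ ((m + 1) * 2) := by
    rw [mul_comm, pow_mul]; norm_num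
  -- Depth `k + 1` gives only `k` contractions. The factor `5/4` lost in this way is covered: `8/5`
  -- appears where `1` would suffice.
  have h6 : ((m : ℝ) + 1) * 2 / (5 / 4 / y) = 8 / 5 * ((m + 1) * y) := by
    field_simp; norm_num
  have h7 : (0 : ℝ) ≤ (m + 1) * y := by positivity
  have h8 : (1 / 4 : ℝ) ^ (m + 1) + ((1 + y) ^ m - 1) / 2 ≤
      (1 / 2) ^ ((m + 1) * 2) + ((m : ℝ) + 1) * 2 / (5 / 4 / y) := by
    rw [h5, h6]
    linarith
  have h9 : (β - 3 / 4 - ε) ≤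
      q * (((1 / 4) ^ (m + 1) + ((1 + y) ^ m - 1) / 2) / τ ^ 2) := by linarith
  calc (β - 3 / 4 - ε) * τ ^ 2
      ≤ q * (((1 / 4) ^ (m + 1) + ((1 + y) ^ m - 1) / 2) / τ ^ 2) * τ ^ 2 :=
        mul_le_mul_of_nonneg_right h9 (by positivity)
    _ = q * ((1 / 4) ^ (m + 1) + ((1 + y) ^ m - 1) / 2) := by field_simp
    _ ≤ _ := mul_le_mul_of_nonneg_left h8 q.cast_nonneg

/-! ### Depth -/

theorem logb_five_fourths_pos : 0 < Real.logb 2 (5 / 4) :=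
  Real.logb_pos (by norm_num) (by norm_num)

theorem le_pow_of_depthConst_mul_le {x : ℝ} {d : ℕ} (hx : 0 < x)
    (h : depthConst * Real.logb 2 x ≤ d) : x ≤ (5 / 4) ^ d := by
  have hL := logb_five_fourths_pos
  rw [depthConst, one_div, inv_mul_le_iff₀ hL] at h
  rw [← Real.logb_le_logb (b := 2) (by norm_num) hx (by positivity), Real.logb_pow]
  linarith

theorem pow_le_of_le_depthConst_mul {x : ℝ} {d : ℕ} (hx : 0 < x)
    (h : d ≤ depthConst * Real.logb 2 x) : (5 / 4) ^ d ≤ x := by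
  have hL := logb_five_fourths_pos
  rw [depthConst, one_div, le_inv_mul_iff₀ hL] at h
  rw [← Real.logb_le_logb (b := 2) (by norm_num) (by positivity) hx, Real.logb_pow]
  linarith

theorem add_logb_eq {n : ℕ} (hn : 0 < n) :
    (n : ℝ) + Real.logb 2 n = Real.logb 2 (2 ^ n * n) := by
  have : (n : ℝ) ≠ 0 := by exact_mod_cast hn.ne'
  rw [Real.logb_mul (by positivity) this, Real.logb_pow, Real.logb_self_eq_one (by norm_num),
    mul_one]

/-- The lower bounds on the number of queries at intermediate and at large depth. -/
theorem query_bound (n m : ℕ) (hnm : n = m * 2) (hn : 1 ≤ n) (d : ℕ) (τ ε β : ℝ)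
    (hτ : 0 < τ) (hε : 0 < ε) (R : Type*) (rep : R → ProbDist (BitString (m * 2)))
    (A : SQAlgorithm (BitString (m * 2)) R) (q : ℕ)
    (hA : LearnsBrickworkFraction m d τ ε β q rep A) :
    (depthConst * Real.logb 2 n ≤ d → d ≤ depthConst * (n + Real.logb 2 n) →
      (β - 3 / 4 - ε - τ) * τ ^ 2 / (3 * n) * (5 / 4) ^ d ≤ (q : ℝ) + 1) ∧
    (depthConst * (n + Real.logb 2 n) < d →
      (β - 3 / 4 - ε - τ) * 2 ^ ((n : ℤ) - 2) * τ ^ 2 ≤ (q : ℝ) + 1) := by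
  have hm : 0 < m := by omega
  have hn0 : (0 : ℝ) < n := by exact_mod_cast hn
  have hnm' : (n : ℝ) = m * 2 := by rw [hnm]; push_cast; rfl
  have hq : (0 : ℝ) ≤ q := q.cast_nonneg
  set K : ℝ := (5 / 4) ^ d with hK
  have hK0 : 0 < K := by positivity
  have htwo : (0 : ℝ) < 2 ^ n := by positivity
  have hτ3 : 0 ≤ τ * τ ^ 2 := by positivity
  have key : (n : ℝ) ≤ K → (β - 3 / 4 - ε) * τ ^ 2 ≤ q * (1 / 2 ^ n + n / K) := by
    intro h
    have := hA.le_mul hτ hε.le hm (by rw [← hnm']; exact h)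
    rwa [← hnm', ← hnm, one_div_pow] at this
  constructor
  · intro h1 h2
    have hnK : (n : ℝ) ≤ K := le_pow_of_depthConst_mul_le hn0 h1
    have hKn : K ≤ 2 ^ n * n := by
      rw [add_logb_eq hn] at h2
      exact pow_le_of_le_depthConst_mul (by positivity) h2
    have h3 := key hnK
    -- Below the threshold `c (n + log n)` the depth-dependent term is the larger one; above it the
    -- order is reversed.
    have h4 : (1 : ℝ) / 2 ^ n ≤ n / K := by
      rw [div_le_div_iff₀ htwo hK0]
      linarith
    have h5 : (β - 3 / 4 - ε) * τ ^ 2 ≤ q * (2 * (n / K)) :=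
      h3.trans (mul_le_mul_of_nonneg_left (by linarith) hq)
    -- The argument loses no `τ` in the success probability; subtracting it only weakens the bound.
    have h6 : (β - 3 / 4 - ε - τ) * τ ^ 2 ≤ q * (2 * (n / K)) := by linarith
    rw [div_mul_eq_mul_div, div_le_iff₀ (by positivity)]
    calc (β - 3 / 4 - ε - τ) * τ ^ 2 * K ≤ q * (2 * (n / K)) * K :=
          mul_le_mul_of_nonneg_right h6 hK0.le
      _ = 2 * (q * n) := by field_simp
      _ ≤ _ := by nlinarith [mul_nonneg hq hn0.le]
  · intro h1
    have hlog : 0 ≤ Real.logb 2 n := Real.logb_nonneg (by norm_num) (by exact_mod_cast hn)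
    have hKn : 2 ^ n * n ≤ K := by
      rw [add_logb_eq hn] at h1
      exact le_pow_of_depthConst_mul_le (by positivity) h1.le
    have hnK : (n : ℝ) ≤ K := by
      refine le_trans ?_ hKn
      have : (1 : ℝ) ≤ 2 ^ n := one_le_pow₀ (by norm_num)
      nlinarith
    have h3 := key hnK
    have h4 : (n : ℝ) / K ≤ 1 / 2 ^ n := by
      rw [div_le_div_iff₀ hK0 htwo]
      linarith
    have h5 : (β - 3 / 4 - ε) * τ ^ 2 ≤ q * (2 * (1 / 2 ^ n)) :=
      h3.trans (mul_le_mul_of_nonneg_left (by linarith) hq)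
    have h6 : (β - 3 / 4 - ε - τ) * τ ^ 2 ≤ q * (2 * (1 / 2 ^ n)) := by linarith
    have hz : (2 : ℝ) ^ ((n : ℤ) - 2) = 2 ^ n / 4 := by
      rw [zpow_sub₀ (by norm_num), zpow_natCast]; norm_num
    rw [hz]
    calc (β - 3 / 4 - ε - τ) * (2 ^ n / 4) * τ ^ 2
        = (β - 3 / 4 - ε - τ) * τ ^ 2 * (2 ^ n / 4) := by ring
      _ ≤ (q : ℝ) * (2 * (1 / 2 ^ n)) * (2 ^ n / 4) :=
          mul_le_mul_of_nonneg_right h6 (by positivity)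
      _ = (q : ℝ) / 2 := by field_simp; norm_num
      _ ≤ _ := by linarith

theorem eventually_pow_lt_two_pow (p : ℕ) : ∀ᶠ n : ℕ in atTop, 4 * (n : ℝ) ^ p < 2 ^ n := by
  have h := tendsto_pow_const_div_const_pow_of_one_lt p (r := (2 : ℝ)) (by norm_num)
  filter_upwards [h.eventually (gt_mem_nhds (show (0 : ℝ) < 1 / 4 by norm_num))] with n hn
  rw [div_lt_iff₀ (by positivity)] at hn
  linarith

end

theorem mainTheorem3 :
    -- the quantitative bounds, for all sufficiently large even `n = m * 2`
    (∃ N : ℕ, ∀ n m : ℕ, n = m * 2 → N ≤ n → ∀ (d : ℕ) (τ ε β : ℝ),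
      0 < τ → 0 < ε → ε ≤ 1 / 4 - τ →
      ∀ (R : Type u) (rep : R → ProbDist (BitString (m * 2)))
        (A : SQAlgorithm (BitString (m * 2)) R) (q : ℕ),
        LearnsBrickworkFraction m d τ ε β q rep A →
        (depthConst * Real.logb 2 n ≤ d → d ≤ depthConst * (n + Real.logb 2 n) →
          (β - 3 / 4 - ε - τ) * τ ^ 2 / (3 * n) * (5 / 4) ^ d ≤ (q : ℝ) + 1) ∧
        (depthConst * (n + Real.logb 2 n) < d →
          (β - 3 / 4 - ε - τ) * 2 ^ ((n : ℤ) - 2) * τ ^ 2 ≤ (q : ℝ) + 1)) ∧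
    -- superpolynomially many queries are needed at depth `ω(log n)`
    (∀ (d : ℕ → ℕ) (τ ε β : ℕ → ℝ) (a : ℕ),
      (fun n : ℕ => Real.logb 2 n) =o[atTop] (fun n : ℕ => (d n : ℝ)) →
      (∀ᶠ n : ℕ in atTop, 0 < ε n ∧ ε n ≤ 1 / 4 - τ n ∧ 1 / (n : ℝ) ^ a ≤ τ n ∧
        1 / (n : ℝ) ^ a ≤ β n - 3 / 4 - ε n - τ n) →
      ∀ k : ℕ, ∃ N : ℕ, ∀ n m : ℕ, n = m * 2 → N ≤ n →
        ∀ (R : Type u) (rep : R → ProbDist (BitString (m * 2)))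
          (A : SQAlgorithm (BitString (m * 2)) R) (q : ℕ),
          LearnsBrickworkFraction m (d n) (τ n) (ε n) (β n) q rep A → n ^ k ≤ q) := by
  refine ⟨⟨1, fun n m hnm hn d τ ε β hτ hε _ R rep A q hA =>
    query_bound n m hnm hn d τ ε β hτ hε R rep A q hA⟩, ?_⟩
  intro d τ ε β a hd hpar k
  have hL := logb_five_fourths_pos
  -- The slack in `β` and the factor `τ ^ 2` cost `n ^ (3 * a)`, the denominator costs `3 * n`. What
  -- is left of `n ^ p` is `n ^ (k + 2) / 3`, more than `n ^ k` once `n ≥ 2`.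
  set p : ℕ := 3 * a + k + 3 with hp
  -- This constant in the little-o condition means `d n ≥ p * c * log n`, that is `(5/4) ^ d ≥ n ^
  -- p`.
  have hd' := hd.def (show 0 < Real.logb 2 (5 / 4) / p by positivity)
  obtain ⟨N, hN⟩ := eventually_atTop.1 (hd'.and (hpar.and
    ((eventually_pow_lt_two_pow (3 * a + k)).and (eventually_ge_atTop 2))))
  refine ⟨N, fun n m hnm hNn R rep A q hA => ?_⟩
  obtain ⟨h1, ⟨hε, -, hτ, hβ⟩, h2, hn2⟩ := hN n hNn
  have hn0 : (0 : ℝ) < n := by exact_mod_cast (by omega : 0 < n)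
  have hn2' : (2 : ℝ) ≤ n := by exact_mod_cast hn2
  have hlog : 0 ≤ Real.logb 2 n := Real.logb_nonneg (by norm_num) (by linarith)
  have hpow : (0 : ℝ) < 1 / (n : ℝ) ^ a := by positivity
  have hτ0 : 0 < τ n := hpow.trans_le hτ
  obtain ⟨hb1, hb2⟩ := query_bound n m hnm (by omega) (d n) (τ n) (ε n) (β n) hτ0 hε R rep A q hA
  rw [Real.norm_of_nonneg hlog, Real.norm_of_nonneg (Nat.cast_nonneg _)] at h1
  have hp0 : (0 : ℝ) < p := by rw [hp]; positivity
  have h3 : depthConst * Real.logb 2 ((n : ℝ) ^ p) ≤ d n := by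
    rw [Real.logb_pow, depthConst, one_div, inv_mul_le_iff₀ hL]
    rw [div_mul_eq_mul_div, le_div_iff₀ hp0] at h1
    linarith
  have h4 : (n : ℝ) ^ p ≤ (5 / 4) ^ (d n) := le_pow_of_depthConst_mul_le (by positivity) h3
  have h5 : depthConst * Real.logb 2 n ≤ d n := by
    refine le_trans (mul_le_mul_of_nonneg_left ?_ ?_) h3
    · rw [Real.logb_pow]
      have : (1 : ℝ) ≤ p := by exact_mod_cast (by omega : 1 ≤ p)
      nlinarith
    · rw [depthConst]; positivity
  have h6 : 1 / (n : ℝ) ^ (3 * a) ≤ (β n - 3 / 4 - ε n - τ n) * τ n ^ 2 := by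
    have : 1 / (n : ℝ) ^ (3 * a) = 1 / (n : ℝ) ^ a * (1 / (n : ℝ) ^ a) ^ 2 := by
      rw [one_div_pow, ← pow_mul, one_div_mul_one_div, ← pow_add]
      congr 2
      ring
    rw [this]
    exact mul_le_mul hβ (pow_le_pow_left₀ hpow.le hτ 2) (by positivity) (hpow.le.trans hβ)
  have hgoal : (n : ℝ) ^ k < q + 1 → n ^ k ≤ q := fun h => by
    have : n ^ k < q + 1 := by exact_mod_cast h
    omega
  apply hgoal
  rcases le_or_gt (d n : ℝ) (depthConst * (n + Real.logb 2 n)) with h7 | h7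
  · refine lt_of_lt_of_le ?_ (hb1 h5 h7)
    calc (n : ℝ) ^ k < n ^ k * (n ^ 2 / 3) := by
          refine lt_mul_of_one_lt_right (by positivity) ?_
          nlinarith
      _ = 1 / (n : ℝ) ^ (3 * a) / (3 * n) * n ^ p := by
          rw [hp, pow_add, pow_add]
          field_simp
      _ ≤ _ := mul_le_mul (div_le_div_of_nonneg_right h6 (by positivity)) h4 (by positivity)
          (div_nonneg (le_trans (by positivity) h6) (by positivity))
  · refine lt_of_lt_of_le ?_ (hb2 h7)
    have hz : (2 : ℝ) ^ ((n : ℤ) - 2) = 2 ^ n / 4 := by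
      rw [zpow_sub₀ (by norm_num), zpow_natCast]; norm_num
    rw [hz]
    calc (n : ℝ) ^ k = 1 / (n : ℝ) ^ (3 * a) * (4 * n ^ (3 * a + k) / 4) := by
          rw [pow_add]
          field_simp
      _ < 1 / (n : ℝ) ^ (3 * a) * (2 ^ n / 4) := by
          refine mul_lt_mul_of_pos_left ?_ (by positivity)
          linarith
      _ ≤ (β n - 3 / 4 - ε n - τ n) * τ n ^ 2 * (2 ^ n / 4) :=
          mul_le_mul_of_nonneg_right h6 (by positivity)
      _ = _ := by ring
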